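/- Let $\Gamma$ be a countable group. A shift system over a finite alphabet $\mathtt A$ is $(\mathtt A^\Gamma,\mu,T)$, where $T^g x(h)=x(g^{-1}h)$ and $\mu$ is a $T$-invariant Borel probability measure; $\mathrm{Prob}(\mathtt A^\Gamma)$ carries the weak* topology. Let $\Sigma=(\sigma_n)_n$ be a sofic approximation by homomorphisms: $V_n$ are non-empty finite sets, $\sigma_n:\Gamma\to\mathrm{Sym}(V_n)$ are homomorphisms, and $|V_n|^{-1}|\{v:\sigma_n(g)v=v\}|\to0$ for every $g\ne 1$. If $\Gamma$ is finite, assume also that $|V_n|\to\infty$ (this is automatic if $\Gamma$ is infinite). For $\mathbf x\in\mathtt A^{V_n}$ let $P_{\mathbf x}^{\sigma_n}=|V_n|^{-1}\sum_{v\in V_n}\delta_{\Pi_v(\mathbf x)}$, where $\Pi_v(\mathbf x)(g)=\mathbf x(\sigma_n(g^{-1})v)$. For $\mathcal O\subseteq\mathrm{Prob}(\mathtt A^\Gamma)$ let $\Omega(\sigma_n,\mathcal O)=\{\mathbf x\in\mathtt A^{V_n}:P_{\mathbf x}^{\sigma_n}\in\mathcal O\}$. The shift system has microstates along $\Sigma$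 if for every neighbourhood $\mathcal O$ of $\mu$ the set $\Omega(\sigma_n,\mathcal O)$ is non-empty for all sufficiently large $n$; a general probability-preserving $\Gamma$-system has microstates along $\Sigma$ if each of its finite-alphabet shift-system factors does. Write $d(\mathbf x,\mathbf y)=|V_n|^{-1}|\{v:\mathbf x(v)\ne\mathbf y(v)\}|$. The shift system has totally shattered microstate spaces along $\Sigma$ if it has microstates along $\Sigma$ and there is $\delta>0$ such that for every $\varepsilon>0$ there are a neighbourhood $\mathcal O$ of $\mu$ and $n_0$ such that for all $n\ge n_0$ and $\mathbf x,\mathbf y\in\Omega(\sigma_n,\mathcal O)$ either $d(\mathbf x,\mathbf y)\ge\delta$ or $d(\mathbf x,\mathbf y)<\varepsilon$. All probability spaces are standard and factor maps are measurable, measure-preserving and almost everywhere equivariant. A Bernoulli shift is $(\mathtt K^\Gamma,\kappa^\Gamma,T)$ with $(\mathtt K,\kappa)$ a standard probability space; it is trivial if $\kappa$ is a point mass. A system is a direct factor of another if it is the image of a factor map $\pi$ for which there is a factor map $\xi$ to a third system such that $(\pi,\xi)$ is an isomorphism onto the product system. A system $(X,\mu,T)$ is weakly contained in $(Y,\nu,S)$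 if for all measurable $C_1,\dots,C_m\subseteq X$, finite $F\subseteq\Gamma$ and $\varepsilon>0$ there are measurable $D_1,\dots,D_m\subseteq Y$ with $|\mu(T^gC_i\cap C_j)-\nu(S^gD_i\cap D_j)|<\varepsilon$ for all $g\in F$ and all $i,j$. For measurable $\phi:X\to\mathtt A$ on a system $(X,\mu,T)$ put $\phi^\Gamma(x)(g)=\phi(T^{g^{-1}}x)$. Suppose that $(\mathtt A^\Gamma,\mu,T)$ has totally shattered microstate spaces along $\Sigma$. Then: (0) For every $\varepsilon>0$ there is a neighbourhood $\mathcal O$ of $\mu$ such that, for every shift system $(\mathtt B^\Gamma,\nu,T)$ over a finite alphabet that has microstates along $\Sigma$, every Bernoulli shift $(\mathtt K^\Gamma,\kappa^\Gamma,T)$ and every measurable $\phi:\mathtt B^\Gamma\times\mathtt K^\Gamma\to\mathtt A$, if $\phi^\Gamma_*(\nu\times\kappa^\Gamma)\in\mathcal O$ then $(\nu\times\kappa^\Gamma\times\kappa^\Gamma)\{(y,z,z'):\phi(y,z)\ne\phi(y,z')\}<\varepsilon$. (1) If $(Y,\theta,S)$ is a probability-preserving $\Gamma$-system that has microstates along $\Sigma$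 and $(\mathtt K^\Gamma,\kappa^\Gamma,T)$ is a Bernoulli shift, then every factor map $\Phi:(Y\times\mathtt K^\Gamma,\theta\times\kappa^\Gamma,S\times T)\to(\mathtt A^\Gamma,\mu,T)$ factorizes through the coordinate projection to $Y$: there is a factor map $\Psi:(Y,\theta,S)\to(\mathtt A^\Gamma,\mu,T)$ with $\Phi(y,z)=\Psi(y)$ for almost every $(y,z)$. (2) Every direct factor of $(\mathtt A^\Gamma,\mu,T)$ that is a Bernoulli shift is trivial. (3) If $(\mathtt A^\Gamma,\mu,T)$ is weakly contained in a Bernoulli shift, then $\mu=\delta_{(\dots,a,a,\dots)}$ for some $a\in\mathtt A$. -/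

import Mathlib

open MeasureTheory Filter Topology
open scoped ENNReal

namespace SoficShift

/-! ### Probability-preserving systems -/

/-- A probability-preserving `Γ`-system structure on `(X, μ)`: a homomorphism from `Γ` to the
group of automorphisms of `(X, μ)`, where maps that agree almost everywhere are identified. -/
structure PMPAction (Γ : Type*) [Group Γ] {X : Type*} [MeasurableSpace X] (μ : Measure X) where
  act : Γ → X → X
  measurePreserving : ∀ g, MeasurePreserving (act g) μ μ
  act_one : act 1 =ᵐ[μ] id
  act_mul : ∀ g h, act (g * h) =ᵐ[μ] act g ∘ act h

/-- The diagonal action on a product system. -/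
def PMPAction.prod {Γ : Type*} [Group Γ]
    {X : Type*} [MeasurableSpace X] {μ : Measure X} [IsProbabilityMeasure μ]
    {Y : Type*} [MeasurableSpace Y] {ν : Measure Y} [IsProbabilityMeasure ν]
    (T : PMPAction Γ μ) (S : PMPAction Γ ν) : PMPAction Γ (μ.prod ν) where
  act g p := (T.act g p.1, S.act g p.2)
  measurePreserving g := (T.measurePreserving g).prod (S.measurePreserving g)
  act_one := by
    filter_upwards [Measure.quasiMeasurePreserving_fst.ae T.act_one,
      Measure.quasiMeasurePreserving_snd.ae S.act_one] with p h₁ h₂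
    simp [h₁, h₂]
  act_mul g h := by
    filter_upwards [Measure.quasiMeasurePreserving_fst.ae (T.act_mul g h),
      Measure.quasiMeasurePreserving_snd.ae (S.act_mul g h)] with p h₁ h₂
    simp [h₁, h₂]

/-- `Φ` is a factor map from `(X, μ, T)` to `(Y, ν, S)`. -/
structure IsFactorMap {Γ : Type*} [Group Γ]
    {X : Type*} [MeasurableSpace X] {μ : Measure X}
    {Y : Type*} [MeasurableSpace Y] {ν : Measure Y}
    (T : PMPAction Γ μ) (S : PMPAction Γ ν) (Φ : X → Y) : Prop where
  aemeasurable : AEMeasurable Φ μ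
  map_eq : μ.map Φ = ν
  equivariant : ∀ g, ∀ᵐ x ∂μ, Φ (T.act g x) = S.act g (Φ x)

/-- `Φ` is an isomorphism of systems: a factor map which is invertible up to null sets. -/
def IsIsomorphism {Γ : Type*} [Group Γ]
    {X : Type*} [MeasurableSpace X] {μ : Measure X}
    {Y : Type*} [MeasurableSpace Y] {ν : Measure Y}
    (T : PMPAction Γ μ) (S : PMPAction Γ ν) (Φ : X → Y) : Prop :=
  IsFactorMap T S Φ ∧ ∃ Ψ : Y → X, IsFactorMap S T Ψ ∧
    (∀ᵐ x ∂μ, Ψ (Φ x) = x) ∧ (∀ᵐ y ∂ν, Φ (Ψ y) = y)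

/-- `(Z, ζ, R)` is a direct factor of `(X, μ, T)`: there are a factor map `π` to it and another
factor map `ξ` to some system on a standard probability space such that `(π, ξ)` is an isomorphism
to the product system. -/
def IsDirectFactor.{w, u, v, t} {Γ : Type t} [Group Γ]
    {Z : Type v} [MeasurableSpace Z] {ζ : Measure Z} [IsProbabilityMeasure ζ]
    {X : Type u} [MeasurableSpace X] {μ : Measure X}
    (R : PMPAction Γ ζ) (T : PMPAction Γ μ) : Prop :=
  ∃ (Y : Type w) (_ : MeasurableSpace Y) (_ : StandardBorelSpace Y)
    (θ : Measure Y) (_ : IsProbabilityMeasure θ) (S : PMPAction Γ θ) (π : X → Z) (ξ : X → Y),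
    IsFactorMap T R π ∧ IsFactorMap T S ξ ∧
      IsIsomorphism T (R.prod S) (fun x => (π x, ξ x))

/-- `(X, μ, T)` is weakly contained in `(Y, ν, S)`. Here `(T.act g⁻¹) ⁻¹' C` is the translate of
the set `C` by `g`, up to a null set. -/
def IsWeaklyContained {Γ : Type*} [Group Γ]
    {X : Type*} [MeasurableSpace X] {μ : Measure X}
    {Y : Type*} [MeasurableSpace Y] {ν : Measure Y}
    (T : PMPAction Γ μ) (S : PMPAction Γ ν) : Prop :=
  ∀ (m : ℕ) (C : Fin m → Set X), (∀ i, MeasurableSet (C i)) →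
    ∀ (F : Finset Γ) (ε : ℝ), 0 < ε →
      ∃ D : Fin m → Set Y, (∀ i, MeasurableSet (D i)) ∧
        ∀ g ∈ F, ∀ i j,
          |μ.real (T.act g⁻¹ ⁻¹' C i ∩ C j) - ν.real (S.act g⁻¹ ⁻¹' D i ∩ D j)| < ε

/-! ### Shift systems and Bernoulli shifts -/

/-- The shift `(T^g x)(h) = x(g⁻¹ h)`. -/
def shift {Γ : Type*} [Group Γ] {A : Type*} (g : Γ) (x : Γ → A) : Γ → A :=
  fun h => x (g⁻¹ * h)

theorem measurable_shift {Γ : Type*} [Group Γ] {A : Type*} [MeasurableSpace A] (g : Γ) :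
    Measurable (shift g : (Γ → A) → Γ → A) :=
  measurable_pi_lambda _ fun _ => measurable_pi_apply _

/-- Invariance of a measure under the shift action. -/
def IsShiftInvariant {Γ : Type*} [Group Γ] {A : Type*} [MeasurableSpace A]
    (μ : Measure (Γ → A)) : Prop :=
  ∀ g : Γ, μ.map (shift g) = μ

/-- The shift system `(A^Γ, μ, T)`. -/
def shiftSystem {Γ : Type*} [Group Γ] {A : Type*} [MeasurableSpace A]
    {μ : Measure (Γ → A)} (hμ : IsShiftInvariant μ) : PMPAction Γ μ where
  act := shift
  measurePreserving g := ⟨measurable_shift g, hμ g⟩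
  act_one := by
    refine Eventually.of_forall fun x => ?_
    funext h
    simp [shift]
  act_mul g h := by
    refine Eventually.of_forall fun x => ?_
    funext k
    simp [shift, mul_assoc]

/-- The product measure `κ^Γ`. -/
noncomputable def bernoulliMeasure (Γ : Type*) {K : Type*} [MeasurableSpace K]
    (κ : Measure K) [IsProbabilityMeasure κ] : Measure (Γ → K) :=
  Measure.infinitePi fun _ : Γ => κ

instance (Γ : Type*) {K : Type*} [MeasurableSpace K] (κ : Measure K) [IsProbabilityMeasure κ] :
    IsProbabilityMeasure (bernoulliMeasure Γ κ) := by
  unfold bernoulliMeasure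
  infer_instance

theorem isShiftInvariant_bernoulliMeasure (Γ : Type*) [Group Γ] {K : Type*} [MeasurableSpace K]
    (κ : Measure K) [IsProbabilityMeasure κ] : IsShiftInvariant (bernoulliMeasure Γ κ) := by
  intro g
  have h := Measure.infinitePi_map_piCongrLeft (fun _ : Γ => κ) (Equiv.mulLeft g)
  have e : (MeasurableEquiv.piCongrLeft (fun _ : Γ => K) (Equiv.mulLeft g) : (Γ → K) → Γ → K)
      = shift g := by
    funext x k
    obtain ⟨k, rfl⟩ := (Equiv.mulLeft g).surjective k
    rw [MeasurableEquiv.coe_piCongrLeft, Equiv.piCongrLeft_apply_apply]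
    simp [shift]
  rw [← e]
  exact h

/-- The Bernoulli shift `(K^Γ, κ^Γ, T)`. -/
noncomputable def bernoulliShift (Γ : Type*) [Group Γ] {K : Type*} [MeasurableSpace K]
    (κ : Measure K) [IsProbabilityMeasure κ] : PMPAction Γ (bernoulliMeasure Γ κ) :=
  shiftSystem (isShiftInvariant_bernoulliMeasure Γ κ)

/-- The equivariant map `φ^Γ : X → A^Γ` induced by `φ : X → A`. -/
def equivariantMap {Γ : Type*} [Group Γ] {X : Type*} [MeasurableSpace X] {μ : Measure X}
    (T : PMPAction Γ μ) {A : Type*} (φ : X → A) : X → Γ → A :=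
  fun x g => φ (T.act g⁻¹ x)

theorem measurable_equivariantMap {Γ : Type*} [Group Γ] {X : Type*} [MeasurableSpace X]
    {μ : Measure X} (T : PMPAction Γ μ) {A : Type*} [MeasurableSpace A] {φ : X → A}
    (hφ : Measurable φ) : Measurable (equivariantMap T φ) :=
  measurable_pi_lambda _ fun g => hφ.comp (T.measurePreserving g⁻¹).measurable

/-- The push-forward of `μ` under `φ^Γ`. -/
noncomputable def equivariantLaw {Γ : Type*} [Group Γ] {X : Type*} [MeasurableSpace X]
    {μ : Measure X} [IsProbabilityMeasure μ] (T : PMPAction Γ μ) {A : Type*} [MeasurableSpace A]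
    {φ : X → A} (hφ : Measurable φ) : ProbabilityMeasure (Γ → A) :=
  ⟨μ.map (equivariantMap T φ),
    Measure.isProbabilityMeasure_map (measurable_equivariantMap T hφ).aemeasurable⟩

/-! ### Sofic approximations and microstates -/

/-- The sequence of maps `σ n : Γ → Sym(V n)` is a sofic approximation: it is asymptotically
homomorphic and asymptotically free. -/
def IsSoficApproximation {Γ : Type*} [Group Γ] {V : ℕ → Type*} [∀ n, Fintype (V n)]
    (σ : ∀ n, Γ → Equiv.Perm (V n)) : Prop :=
  (∀ g h : Γ, Tendsto (fun n =>
      (Set.ncard {v : V n | σ n (g * h) v = σ n g (σ n h v)} : ℝ) / Fintype.card (V n))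
      atTop (𝓝 1)) ∧
  (∀ g : Γ, g ≠ 1 → Tendsto (fun n =>
      (Set.ncard {v : V n | σ n g v = v} : ℝ) / Fintype.card (V n)) atTop (𝓝 0))

/-- The pullback name `Π_v^σ(x) ∈ A^Γ` of `x : V → A` at `v`. -/
def pullbackName {Γ : Type*} [Group Γ] {V A : Type*} (σ : Γ → Equiv.Perm V) (x : V → A) (v : V) :
    Γ → A :=
  fun g => x (σ g⁻¹ v)

/-- The empirical measure `P_x^σ` of `x : V → A`. -/
noncomputable def empiricalMeasure {Γ : Type*} [Group Γ] {V A : Type*} [Fintype V] [Nonempty V]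
    [MeasurableSpace A] (σ : Γ → Equiv.Perm V) (x : V → A) : ProbabilityMeasure (Γ → A) :=
  ⟨(Fintype.card V : ℝ≥0∞)⁻¹ • ∑ v, Measure.dirac (pullbackName σ x v), ⟨by
    simp [ENNReal.inv_mul_cancel]⟩⟩

/-- The set `Ω(σ, O)` of `(O, σ)`-microstates. -/
def microstates {Γ : Type*} [Group Γ] {V A : Type*} [Fintype V] [Nonempty V]
    [MeasurableSpace A] (σ : Γ → Equiv.Perm V) (O : Set (ProbabilityMeasure (Γ → A))) :
    Set (V → A) :=
  {x | empiricalMeasure σ x ∈ O}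

/-- The normalized Hamming distance. -/
noncomputable def normHamming {V A : Type*} [Fintype V] (x y : V → A) : ℝ :=
  (Set.ncard {v | x v ≠ y v} : ℝ) / Fintype.card V

/-- The shift system over the finite alphabet `A` with invariant measure `μ` has microstates along
`σ`. -/
def HasMicrostates {Γ : Type*} [Group Γ] [Countable Γ] {V : ℕ → Type*} [∀ n, Fintype (V n)]
    [∀ n, Nonempty (V n)] (σ : ∀ n, Γ → Equiv.Perm (V n))
    {A : Type*} [Finite A] [TopologicalSpace A] [DiscreteTopology A] [MeasurableSpace A]
    [BorelSpace A] (μ : ProbabilityMeasure (Γ → A)) : Prop :=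
  ∀ O ∈ 𝓝 μ, ∀ᶠ n in atTop, (microstates (σ n) O).Nonempty

/-- An arbitrary probability-preserving system has microstates along `σ` if each of its
finite-alphabet shift-system factors does. -/
def SystemHasMicrostates {Γ : Type*} [Group Γ] [Countable Γ] {V : ℕ → Type*}
    [∀ n, Fintype (V n)] [∀ n, Nonempty (V n)] (σ : ∀ n, Γ → Equiv.Perm (V n))
    {Y : Type*} [MeasurableSpace Y] {θ : Measure Y} (S : PMPAction Γ θ) : Prop :=
  ∀ (B : Type) [Finite B] [TopologicalSpace B] [DiscreteTopology B] [MeasurableSpace B]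
    [BorelSpace B] (ν : ProbabilityMeasure (Γ → B))
    (hν : IsShiftInvariant (ν : Measure (Γ → B))) (Φ : Y → Γ → B),
    IsFactorMap S (shiftSystem hν) Φ → HasMicrostates σ ν

/-- The shift system over the finite alphabet `A` with invariant measure `μ` has totally shattered
microstate spaces along `σ`. -/
def HasTotallyShatteredMicrostates {Γ : Type*} [Group Γ] [Countable Γ] {V : ℕ → Type*}
    [∀ n, Fintype (V n)] [∀ n, Nonempty (V n)] (σ : ∀ n, Γ → Equiv.Perm (V n))
    {A : Type*} [Finite A] [TopologicalSpace A] [DiscreteTopology A] [MeasurableSpace A]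
    [BorelSpace A] (μ : ProbabilityMeasure (Γ → A)) : Prop :=
  HasMicrostates σ μ ∧
  ∃ δ : ℝ, 0 < δ ∧ ∀ ε : ℝ, 0 < ε → ∃ O ∈ 𝓝 μ, ∃ n₀ : ℕ, ∀ n ≥ n₀,
    ∀ x ∈ microstates (σ n) O, ∀ y ∈ microstates (σ n) O,
      δ ≤ normHamming x y ∨ normHamming x y < ε

end SoficShift

open SoficShift

universe uΓ uV uA uB uK uY

namespace SoficShift

/-! ### Frequencies and local events -/

/-! Let `φ : Y × (Γ → K) → A` induce a process with law near `μ`, and let `z`, `z'` be independent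
Bernoulli samples. Give every `g : Γ` an independent uniform clock with `N` values, and let `z_j` be
`z` with the entries of clock less than `j` replaced by those of `z'`. Then `z_0 = z`, `z_N = z'`,
and each `(y, z_j)` has the law of `(y, z)`. Since `φ` nearly depends on finitely many coordinates,
`φ(y, z_j)` and `φ(y, z_{j+1})` rarely differ once `N` is large (`exists_resample_step_lt`). The
joint process of all `φ(y, z_j)` is a factor of `Y` times Bernoulli shifts, so it has finite models
over `V n`. The components of one model are microstates `x_0, …, x_N` for `μ` with short consecutive
Hamming distances. A chain with short steps cannot cross the gap in the possible distances, so `x_N`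
stays close to `x_0`, which means that `φ(y, z) = φ(y, z')` with high probability. This is
`HasTotallyShatteredMicrostates.exists_nhds_forall_lt`.

Models pass from `Y` to `Y × K^Γ` by `AllModels.prod_bernoulliShift`: a model for `Y` is combined
with a random labelling of `V n`, whose pattern frequencies concentrate by a second-moment bound,
because asymptotic freeness makes most windows injective and most pairs of windows disjoint.

The other conclusions follow. For an exact factor map the law lies in every neighbourhood of `μ`, so
the disagreement has probability zero and the map factors through `Y`. If `A^Γ` is isomorphic to
`K^Γ × Y`, the inverse isomorphism factors through `Y`, so the Bernoulli coordinate is both a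
function of `y` and independent of `y`, hence constant. If `μ` is weakly contained in a Bernoulli
shift, some `φ` on that shift has law near `μ` (`IsWeaklyContained.exists_equivariantLaw_mem`); with
`Y` a point, `φ` is nearly constant. -/

/-- The proportion of points of a finite set `V` that lie in `P`. -/
noncomputable def freq {V : Type*} [Fintype V] (P : Set V) : ℝ :=
  (P.ncard : ℝ) / Fintype.card V

theorem freq_nonneg {V : Type*} [Fintype V] (P : Set V) : 0 ≤ freq P := by
  unfold freq; positivity

theorem freq_mono {V : Type*} [Fintype V] {P Q : Set V} (h : P ⊆ Q) : freq P ≤ freq Q := by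
  unfold freq
  gcongr
  exact Q.toFinite

theorem freq_union_le {V : Type*} [Fintype V] (P Q : Set V) :
    freq (P ∪ Q) ≤ freq P + freq Q := by
  unfold freq
  rw [← add_div]
  gcongr
  exact_mod_cast Set.ncard_union_le P Q

theorem freq_biUnion_le {V ι : Type*} [Fintype V] (s : Finset ι) (P : ι → Set V) :
    freq (⋃ i ∈ s, P i) ≤ ∑ i ∈ s, freq (P i) := by
  classical
  induction s using Finset.induction_on with
  | empty => simp [freq]
  | insert a s ha ih =>
    rw [Finset.set_biUnion_insert, Finset.sum_insert ha]
    exact (freq_union_le _ _).trans (by gcongr)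

theorem freq_univ {V : Type*} [Fintype V] [Nonempty V] : freq (Set.univ : Set V) = 1 := by
  unfold freq
  rw [Set.ncard_univ, Nat.card_eq_fintype_card]
  exact div_self (by positivity)

/-- The event `E` in `A^Γ` depends only on the coordinates in `W`. -/
def IsLocal {Γ A : Type*} (W : Finset Γ) (E : Set (Γ → A)) : Prop :=
  ∀ ⦃a b : Γ → A⦄, (∀ g ∈ W, a g = b g) → a ∈ E → b ∈ E

theorem IsLocal.mono {Γ A : Type*} {W W' : Finset Γ} {E : Set (Γ → A)} (h : IsLocal W E)
    (hW : W ⊆ W') : IsLocal W' E :=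
  fun _ _ hab ha => h (fun g hg => hab g (hW hg)) ha

theorem IsLocal.eq_preimage {Γ A : Type*} {W : Finset Γ} {E : Set (Γ → A)} (h : IsLocal W E) :
    E = W.restrict ⁻¹' (W.restrict '' E) := by
  refine Set.Subset.antisymm (Set.subset_preimage_image _ _) ?_
  rintro b ⟨a, ha, hab⟩
  exact h (fun g hg => congrFun hab ⟨g, hg⟩) ha

theorem isLocal_preimage_restrict {Γ A : Type*} (W : Finset Γ) (E : Set (W → A)) :
    IsLocal W (W.restrict ⁻¹' E) := by
  intro a b hab ha
  have : W.restrict a = W.restrict b := funext fun g => hab g g.2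
  simpa [← this] using ha

theorem IsLocal.isClopen {Γ A : Type*} [TopologicalSpace A] [DiscreteTopology A]
    {W : Finset Γ} {E : Set (Γ → A)} (h : IsLocal W E) : IsClopen E := by
  rw [h.eq_preimage]
  exact (isClopen_discrete _).preimage (by fun_prop)

theorem IsLocal.measurableSet {Γ A : Type*} [Finite A] [MeasurableSpace A]
    [MeasurableSingletonClass A] {W : Finset Γ} {E : Set (Γ → A)} (h : IsLocal W E) :
    MeasurableSet E := by
  rw [h.eq_preimage]
  exact W.measurable_restrict (Set.toFinite _).measurableSet

theorem empiricalMeasure_real {Γ : Type*} [Group Γ] {V A : Type*} [Fintype V] [Nonempty V]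
    [MeasurableSpace A] (σ : Γ → Equiv.Perm V) (x : V → A) {E : Set (Γ → A)}
    (hE : MeasurableSet E) :
    (empiricalMeasure σ x : Measure (Γ → A)).real E = freq {v | pullbackName σ x v ∈ E} := by
  classical
  have h : (empiricalMeasure σ x : Measure (Γ → A)) =
      (Fintype.card V : ℝ≥0∞)⁻¹ • ∑ v, Measure.dirac (pullbackName σ x v) := rfl
  rw [h, measureReal_def, Measure.smul_apply, Measure.finsetSum_apply]
  simp_rw [Measure.dirac_apply' _ hE]
  have : ∑ v, E.indicator (1 : (Γ → A) → ℝ≥0∞) (pullbackName σ x v) =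
      ({v | pullbackName σ x v ∈ E}.ncard : ℝ≥0∞) := by
    simp only [Set.indicator_apply, Pi.one_apply]
    rw [Finset.sum_boole, Set.ncard_eq_toFinset_card']
    congr 2
    ext v
    simp
  rw [this, smul_eq_mul, ENNReal.toReal_mul, ENNReal.toReal_inv]
  simp [freq, div_eq_inv_mul]

/-! ### Neighbourhoods in the space of measures on a shift space -/

theorem eventually_nhds_forall_isLocal {Γ : Type*} [Countable Γ] {A : Type*} [Finite A]
    [TopologicalSpace A] [DiscreteTopology A] [MeasurableSpace A] [BorelSpace A]
    (μ : ProbabilityMeasure (Γ → A)) (W : Finset Γ) {η : ℝ} (hη : 0 < η) :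
    ∀ᶠ ν : ProbabilityMeasure (Γ → A) in 𝓝 μ, ∀ E, IsLocal W E →
      |(ν : Measure (Γ → A)).real E - (μ : Measure (Γ → A)).real E| < η := by
  have h : ∀ E : Set (W → A), ∀ᶠ ν : ProbabilityMeasure (Γ → A) in 𝓝 μ,
      |(ν : Measure (Γ → A)).real (W.restrict ⁻¹' E) -
        (μ : Measure (Γ → A)).real (W.restrict ⁻¹' E)| < η := by
    intro E
    have := ProbabilityMeasure.tendsto_measure_of_isClopen_of_tendsto
      (tendsto_id (x := 𝓝 μ)) (isLocal_preimage_restrict W E).isClopen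
    have := (NNReal.tendsto_coe.2 this).eventually (Metric.ball_mem_nhds _ hη)
    simpa [Metric.mem_ball, Real.dist_eq] using this
  filter_upwards [eventually_all.2 h] with ν hν E hE
  rw [hE.eq_preimage]
  exact hν _

/-- Together with `eventually_nhds_forall_isLocal`, this reduces weak* neighbourhoods to statistics
on finite windows. Otherwise, along windows exhausting the countable group, there would be measures
outside `O` whose local statistics tend to those of `μ`; local events form a π-system containing
arbitrarily small clopen neighbourhoods, so these measures would converge to `μ`. -/
theorem exists_local_nhds {Γ : Type*} [Countable Γ] {A : Type*} [Finite A]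
    [TopologicalSpace A] [DiscreteTopology A] [MeasurableSpace A] [BorelSpace A]
    {μ : ProbabilityMeasure (Γ → A)} {O : Set (ProbabilityMeasure (Γ → A))} (hO : O ∈ 𝓝 μ) :
    ∃ (W : Finset Γ) (η : ℝ), 0 < η ∧ ∀ ν : ProbabilityMeasure (Γ → A),
      (∀ E, IsLocal W E →
        |(ν : Measure (Γ → A)).real E - (μ : Measure (Γ → A)).real E| < η) → ν ∈ O := by
  classical
  by_contra! hcon
  obtain ⟨e, he⟩ := exists_injective_nat Γ
  have hfin : ∀ k, {g | e g ≤ k}.Finite := fun k =>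
    (Set.finite_Iic k).preimage he.injOn
  choose ν hν hνO using fun k : ℕ => hcon (hfin k).toFinset (1 / ((k : ℝ) + 1)) (by positivity)
  have key : Tendsto ν atTop (𝓝 μ) := by
    refine IsPiSystem.tendsto_probabilityMeasure_of_tendsto_of_mem
      (S := {E : Set (Γ → A) | ∃ W : Finset Γ, IsLocal W E}) ?_ ?_ ?_ ?_
    · rintro E ⟨W, hE⟩ F ⟨W', hF⟩ -
      exact ⟨W ∪ W', fun a b hab ha =>
        ⟨hE (fun g hg => hab g (Finset.mem_union_left _ hg)) ha.1,
          hF (fun g hg => hab g (Finset.mem_union_right _ hg)) ha.2⟩⟩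
    · rintro E ⟨W, hE⟩
      exact hE.measurableSet
    · intro u hu a ha
      obtain ⟨I, t, ht, htu⟩ := isOpen_pi_iff.1 hu a ha
      refine ⟨{b | ∀ g ∈ I, b g = a g}, ⟨I, fun b c hbc hb g hg => (hbc g hg).symm.trans (hb g hg)⟩,
        ?_, ?_⟩
      · refine IsOpen.mem_nhds (IsClopen.isOpen (IsLocal.isClopen (W := I) ?_)) ?_
        · exact fun b c hbc hb g hg => (hbc g hg).symm.trans (hb g hg)
        · exact fun g _ => rfl
      · intro b hb
        exact htu fun g hg => by rw [hb g hg]; exact (ht g hg).2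
    · rintro E ⟨W, hE⟩
      rw [← NNReal.tendsto_coe, tendsto_iff_dist_tendsto_zero]
      refine squeeze_zero' (Eventually.of_forall fun _ => dist_nonneg) ?_
        tendsto_one_div_add_atTop_nhds_zero_nat
      obtain ⟨m, hm⟩ := (W.image e).bddAbove
      filter_upwards [eventually_ge_atTop m] with k hk
      refine (hν k E (hE.mono fun g hg => ?_)).le
      have : e g ≤ m := hm (by simpa using ⟨g, hg, rfl⟩)
      simpa using this.trans hk
  obtain ⟨k, hk⟩ := (key.eventually hO).exists
  exact hνO k hk

/-! ### Models of finite-valued maps -/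

/-- The finite-valued map `φ` on the system `S` has models along `σ`: its local statistics are
arbitrarily well approximated by those of labellings of the sets `V n`. -/
def HasModels {Γ : Type*} [Group Γ] {V : ℕ → Type*} [∀ n, Fintype (V n)]
    (σ : ∀ n, Γ →* Equiv.Perm (V n)) {X : Type*} [MeasurableSpace X] {θ : Measure X}
    (S : PMPAction Γ θ) {A : Type*} (φ : X → A) : Prop :=
  ∀ (W : Finset Γ) (η : ℝ), 0 < η → ∀ᶠ n in atTop, ∃ x : V n → A, ∀ E : Set (Γ → A),
    IsLocal W E →
      |freq {v | pullbackName (σ n) x v ∈ E} - θ.real {y | equivariantMap S φ y ∈ E}| < η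

/-- All finite-valued measurable maps on the system `S` have models along `σ`. -/
def AllModels {Γ : Type*} [Group Γ] {V : ℕ → Type*} [∀ n, Fintype (V n)]
    (σ : ∀ n, Γ →* Equiv.Perm (V n)) {X : Type*} [MeasurableSpace X] {θ : Measure X}
    (S : PMPAction Γ θ) : Prop :=
  ∀ (m : ℕ) (φ : X → Fin m), Measurable φ → HasModels σ S φ

section Models

set_option linter.unusedSectionVars false

variable {Γ : Type*} [Group Γ] [Countable Γ] {V : ℕ → Type*} [∀ n, Fintype (V n)]
  {σ : ∀ n, Γ →* Equiv.Perm (V n)}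
  {X : Type*} [MeasurableSpace X] {θ : Measure X} [IsProbabilityMeasure θ] {S : PMPAction Γ θ}

theorem equivariantMap_act (S : PMPAction Γ θ) {B : Type*} (β : X → B) :
    ∀ᵐ x ∂θ, ∀ h, equivariantMap S β (S.act h x) = shift h (equivariantMap S β x) := by
  refine ae_all_iff.2 fun h => ?_
  have : ∀ᵐ x ∂θ, ∀ g, S.act (g⁻¹ * h) x = S.act g⁻¹ (S.act h x) :=
    ae_all_iff.2 fun g => S.act_mul g⁻¹ h
  filter_upwards [this] with x hx
  funext g
  simp [equivariantMap, shift, ← hx]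

/-- Models of `β` are turned into models of a finite block code of `β`. -/
theorem HasModels.blockCode {A B : Type*} {β : X → B} (hβ : HasModels σ S β) {W₀ : Finset Γ}
    {f : (Γ → B) → A} (hf : DependsOn f (W₀ : Set Γ)) :
    HasModels σ S (fun x => f (equivariantMap S β x)) := by
  classical
  intro W η hη
  -- The code at position `h` reads `β` on `h W₀`, so the window `W W₀` is needed.
  filter_upwards [hβ (Finset.image₂ (· * ·) W W₀) η hη] with n hn
  obtain ⟨b, hb⟩ := hn
  refine ⟨fun v => f (pullbackName (σ n) b v), fun E hE => ?_⟩
  have hloc : IsLocal (Finset.image₂ (· * ·) W W₀)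
      {c : Γ → B | (fun h => f (shift h⁻¹ c)) ∈ E} := by
    intro c d hcd hc
    refine hE (fun h hh => hf fun g hg => ?_) hc
    simpa [shift] using hcd (h * g) (Finset.mem_image₂_of_mem hh (by simpa using hg))
  convert hb _ hloc using 3
  · congr 1
    ext v
    -- Since `σ n` is a homomorphism, coding commutes exactly with taking names and no error term
    -- arises.
    have : pullbackName (σ n) (fun v => f (pullbackName (σ n) b v)) v =
        fun h => f (shift h⁻¹ (pullbackName (σ n) b v)) := by
      funext h
      simp only [pullbackName]
      congr 1
      funext g
      simp [shift, pullbackName]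
    simp only [Set.mem_ofPred_eq]
    rw [this]
  · refine measureReal_congr ?_
    filter_upwards [equivariantMap_act S β] with x hx
    refine propext ?_
    change _ ∈ E ↔ _ ∈ E
    have : equivariantMap S (fun x => f (equivariantMap S β x)) x =
        fun h => f (shift h⁻¹ (equivariantMap S β x)) := by
      funext h
      rw [← hx h⁻¹]
      rfl
    rw [this]

theorem HasModels.comp {A B : Type*} {β : X → B} (hβ : HasModels σ S β) (f : B → A) :
    HasModels σ S (fun x => f (β x)) := by
  intro W η hη
  filter_upwards [hβ W η hη] with n hn
  obtain ⟨b, hb⟩ := hn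
  refine ⟨fun v => f (b v), fun E hE => ?_⟩
  refine hb {c | (fun g => f (c g)) ∈ E} fun c d hcd hc => hE (fun g hg => ?_) hc
  simp [hcd g hg]

theorem AllModels.hasModels (h : AllModels σ S) {A : Type*} [Finite A] [MeasurableSpace A]
    [MeasurableSingletonClass A] {φ : X → A} (hφ : Measurable φ) : HasModels σ S φ := by
  obtain ⟨m, ⟨e⟩⟩ := Finite.exists_equiv_fin A
  have := (h m (fun x => e (φ x)) ((measurable_of_finite e).comp hφ)).comp e.symm
  simpa using this

/-- The maps that have models form a closed set for convergence in measure. -/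
theorem HasModels.of_approx {A : Type*} [Finite A] [MeasurableSpace A]
    [MeasurableSingletonClass A] {φ : X → A} (hφ : Measurable φ)
    (h : ∀ η : ℝ, 0 < η → ∃ φ' : X → A, Measurable φ' ∧ HasModels σ S φ' ∧
      θ.real {x | φ x ≠ φ' x} < η) :
    HasModels σ S φ := by
  intro W η hη
  -- Half of `η` pays for the model of `φ'`, and half for a union bound over `W`; the `+ 1` covers
  -- an empty window.
  obtain ⟨φ', hφ', hmod, hdist⟩ := h (η / 2 / (W.card + 1)) (by positivity)
  filter_upwards [hmod W (η / 2) (half_pos hη)] with n hn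
  obtain ⟨x, hx⟩ := hn
  refine ⟨x, fun E hE => ?_⟩
  have hnull : NullMeasurableSet {x | φ x ≠ φ' x} θ :=
    (measurableSet_eq_fun hφ hφ').compl.nullMeasurableSet
  set D : Set X := ⋃ g ∈ W, S.act g⁻¹ ⁻¹' {x | φ x ≠ φ' x} with hD
  have hDle : θ.real D ≤ η / 2 := by
    calc θ.real D ≤ ∑ g ∈ W, θ.real (S.act g⁻¹ ⁻¹' {x | φ x ≠ φ' x}) :=
          measureReal_biUnion_finset_le _ _
      _ = ∑ g ∈ W, θ.real {x | φ x ≠ φ' x} := by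
          refine Finset.sum_congr rfl fun g _ => ?_
          rw [measureReal_def, (S.measurePreserving g⁻¹).measure_preimage hnull, measureReal_def]
      _ = W.card * θ.real {x | φ x ≠ φ' x} := by simp
      _ ≤ W.card * (η / 2 / (W.card + 1)) := by gcongr
      _ ≤ (W.card + 1) * (η / 2 / (W.card + 1)) := by gcongr; linarith
      _ = η / 2 := by field_simp
  have hagree : ∀ y ∉ D, ∀ g ∈ W, equivariantMap S φ y g = equivariantMap S φ' y g := by
    intro y hy g hg
    by_contra hne
    exact hy (Set.mem_biUnion hg hne)
  have h₁ : θ.real {y | equivariantMap S φ y ∈ E} ≤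
      θ.real {y | equivariantMap S φ' y ∈ E} + θ.real D := by
    refine (measureReal_mono ?_).trans (measureReal_union_le _ _)
    intro y hy
    by_cases hyD : y ∈ D
    · exact Or.inr hyD
    · exact Or.inl (hE (hagree y hyD) hy)
  have h₂ : θ.real {y | equivariantMap S φ' y ∈ E} ≤
      θ.real {y | equivariantMap S φ y ∈ E} + θ.real D := by
    refine (measureReal_mono ?_).trans (measureReal_union_le _ _)
    intro y hy
    by_cases hyD : y ∈ D
    · exact Or.inr hyD
    · exact Or.inl (hE (fun g hg => (hagree y hyD g hg).symm) hy)
  have h₃ := abs_lt.1 (hx E hE)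
  exact abs_lt.2 ⟨by linarith [h₃.1, h₃.2], by linarith [h₃.1, h₃.2]⟩

theorem HasModels.congr_ae {A : Type*} {φ φ' : X → A} (h : HasModels σ S φ)
    (hφ : φ =ᵐ[θ] φ') : HasModels σ S φ' := by
  intro W η hη
  filter_upwards [h W η hη] with n hn
  obtain ⟨x, hx⟩ := hn
  refine ⟨x, fun E hE => ?_⟩
  convert hx E hE using 3
  refine measureReal_congr ?_
  have : ∀ᵐ y ∂θ, ∀ g, φ (S.act g⁻¹ y) = φ' (S.act g⁻¹ y) := ae_all_iff.2 fun g =>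
    (S.measurePreserving g⁻¹).quasiMeasurePreserving.ae hφ
  filter_upwards [this] with y hy
  refine propext ?_
  change _ ∈ E ↔ _ ∈ E
  rw [show equivariantMap S φ y = equivariantMap S φ' y from funext hy]

/-! ### Relation with microstates -/

theorem isShiftInvariant_map_equivariantMap {A : Type*} [MeasurableSpace A] {φ : X → A}
    (hφ : Measurable φ) : IsShiftInvariant (θ.map (equivariantMap S φ)) := by
  intro g
  have hm := measurable_equivariantMap S hφ
  rw [Measure.map_map (measurable_shift g) hm]
  have : shift g ∘ equivariantMap S φ =ᵐ[θ] equivariantMap S φ ∘ S.act g := by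
    filter_upwards [equivariantMap_act S φ] with x hx
    exact (hx g).symm
  rw [Measure.map_congr this, ← Measure.map_map hm (S.measurePreserving g).measurable,
    (S.measurePreserving g).map_eq]

theorem isFactorMap_equivariantMap {A : Type*} [MeasurableSpace A] {φ : X → A}
    (hφ : Measurable φ) {ν : Measure (Γ → A)} (hν : IsShiftInvariant ν)
    (h : θ.map (equivariantMap S φ) = ν) :
    IsFactorMap S (shiftSystem hν) (equivariantMap S φ) where
  aemeasurable := (measurable_equivariantMap S hφ).aemeasurable
  map_eq := h
  equivariant g := by
    filter_upwards [equivariantMap_act S φ] with x hx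
    exact hx g

variable [∀ n, Nonempty (V n)]

theorem HasMicrostates.hasModels {A : Type*} [Finite A] [TopologicalSpace A] [DiscreteTopology A]
    [MeasurableSpace A] [BorelSpace A] {ν : ProbabilityMeasure (Γ → A)}
    (h : HasMicrostates (fun n => ⇑(σ n)) ν) {φ : X → A} (hφ : Measurable φ)
    (hν : θ.map (equivariantMap S φ) = ν) : HasModels σ S φ := by
  intro W η hη
  filter_upwards [h _ (eventually_nhds_forall_isLocal ν W hη)] with n hn
  obtain ⟨x, hx⟩ := hn
  refine ⟨x, fun E hE => ?_⟩
  have := hx E hE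
  rwa [empiricalMeasure_real _ _ hE.measurableSet, ← hν,
    map_measureReal_apply (measurable_equivariantMap S hφ) hE.measurableSet] at this

/-- The process of a finite-valued map is itself a finite-alphabet shift factor, so its microstates
are models of the map. -/
theorem SystemHasMicrostates.allModels (h : SystemHasMicrostates (fun n => ⇑(σ n)) S) :
    AllModels σ S := by
  intro m φ hφ
  let : TopologicalSpace (Fin m) := ⊥
  have : DiscreteTopology (Fin m) := ⟨rfl⟩
  have : BorelSpace (Fin m) := ⟨by
    rw [borel_eq_top_of_discrete]
    rfl⟩
  have hinv := isShiftInvariant_map_equivariantMap (S := S) hφ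
  exact (h (Fin m) (equivariantLaw S hφ) hinv (equivariantMap S φ)
    (isFactorMap_equivariantMap hφ hinv rfl)).hasModels hφ rfl

end Models

/-! ### Approximation of finite-valued maps by maps determined by finitely many events -/

theorem exists_finset_of_mem_generateSetAlgebra {X : Type*} {G : Set (Set X)} {D : Set X}
    (hD : D ∈ generateSetAlgebra G) :
    ∃ t : Finset (Set X), ↑t ⊆ G ∧ ∀ x y, (∀ C ∈ t, (x ∈ C ↔ y ∈ C)) → (x ∈ D ↔ y ∈ D) := by
  classical
  induction hD with
  | base s hs => exact ⟨{s}, by simpa using hs, fun x y h => h s (by simp)⟩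
  | empty => exact ⟨∅, by simp, fun x y _ => by simp⟩
  | compl s _ ih =>
    obtain ⟨t, ht, h⟩ := ih
    exact ⟨t, ht, fun x y hxy => not_congr (h x y hxy)⟩
  | union s u _ _ ihs ihu =>
    obtain ⟨t, ht, h⟩ := ihs
    obtain ⟨t', ht', h'⟩ := ihu
    refine ⟨t ∪ t', by simp [ht, ht'], fun x y hxy => or_congr (h x y fun C hC => ?_)
      (h' x y fun C hC => ?_)⟩
    · exact hxy C (Finset.mem_union_left _ hC)
    · exact hxy C (Finset.mem_union_right _ hC)

-- Each level set of `φ` is close in measure to a set `D a` of the generated algebra, which involves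
-- finitely many generators. Decoding the vector of memberships in the `D a` recovers `φ` off the
-- symmetric differences.
open scoped symmDiff in
theorem exists_approx_of_generateFrom {X : Type*} [mX : MeasurableSpace X] {μ : Measure X}
    [IsProbabilityMeasure μ] {G : Set (Set X)} (hG : mX = MeasurableSpace.generateFrom G)
    {A : Type*} [Finite A] [MeasurableSpace A] [MeasurableSingletonClass A] {φ : X → A}
    (hφ : Measurable φ) {η : ℝ} (hη : 0 < η) :
    ∃ (t : Finset (Set X)) (φ' : X → A), ↑t ⊆ G ∧ Measurable φ' ∧
      (∀ x y, (∀ C ∈ t, (x ∈ C ↔ y ∈ C)) → φ' x = φ' y) ∧ μ.real {x | φ x ≠ φ' x} < η := by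
  classical
  cases nonempty_fintype A
  have : Nonempty X := nonempty_of_isProbabilityMeasure μ
  have : Nonempty A := this.map φ
  have halg := isSetAlgebra_generateSetAlgebra (𝒜 := G)
  have hgen : mX = MeasurableSpace.generateFrom (generateSetAlgebra G) := by
    rw [generateFrom_generateSetAlgebra_eq, hG]
  have hη' : 0 < η / (Fintype.card A + 1) := by positivity
  have happ : ∀ a, ∃ D ∈ generateSetAlgebra G,
      μ (D ∆ (φ ⁻¹' {a})) < ENNReal.ofReal (η / (Fintype.card A + 1)) := fun a =>
    exists_measure_symmDiff_lt_of_generateFrom_isSetRing halg.isSetRing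
      ⟨{Set.univ}, by simp, by simpa using halg.univ_mem, by simp⟩ hgen
      (hφ (measurableSet_singleton a)) (ENNReal.ofReal_pos.2 hη')
  choose D hD hDμ using happ
  choose t ht htD using fun a => exists_finset_of_mem_generateSetAlgebra (hD a)
  have hDm : ∀ a, MeasurableSet (D a) := fun a => by
    rw [hgen]
    exact MeasurableSpace.measurableSet_generateFrom (hD a)
  -- The decoder returns `a` on the indicator vector of `a`; its value on other vectors is
  -- irrelevant.
  let F : (A → Prop) → A := fun P =>
    if h : ∃ a, P = (fun b => b = a) then h.choose else Classical.arbitrary A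
  have hF : ∀ a, F (fun b => b = a) = a := by
    intro a
    have h : ∃ a', (fun b => b = a) = (fun b => b = a') := ⟨a, rfl⟩
    simp only [F, dif_pos h]
    have : a = h.choose := by simpa using congrFun h.choose_spec a
    exact this.symm
  refine ⟨Finset.univ.biUnion t, fun x => F fun a => x ∈ D a, ?_, ?_, ?_, ?_⟩
  · simpa using ht
  · exact (measurable_of_finite F).comp
      (measurable_pi_lambda _ fun a => measurableSet_setOfPred.1 (hDm a))
  · intro x y hxy
    simp only
    congr 1
    funext a
    exact propext (htD a x y fun C hC => hxy C (Finset.mem_biUnion.2 ⟨a, Finset.mem_univ _, hC⟩))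
  · have hsub : {x | φ x ≠ F fun a => x ∈ D a} ⊆ ⋃ a ∈ Finset.univ, D a ∆ (φ ⁻¹' {a}) := by
      intro x hx
      by_contra hcon
      apply hx
      have : (fun a => x ∈ D a) = (fun b => b = φ x) := by
        funext a
        have hxa : x ∉ D a ∆ (φ ⁻¹' {a}) := fun h =>
          hcon (Set.mem_biUnion (Finset.mem_univ a) h)
        rw [Set.mem_symmDiff] at hxa
        simp only [Set.mem_preimage, Set.mem_singleton_iff] at hxa
        refine propext ⟨fun h => ?_, fun h => ?_⟩
        · by_contra hne
          exact hxa (Or.inl ⟨h, fun h' => hne h'.symm⟩)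
        · by_contra hne
          exact hxa (Or.inr ⟨h.symm, hne⟩)
      rw [this, hF]
    calc μ.real {x | φ x ≠ F fun a => x ∈ D a}
        ≤ μ.real (⋃ a ∈ Finset.univ, D a ∆ (φ ⁻¹' {a})) := measureReal_mono hsub (measure_ne_top _ _)
      _ ≤ ∑ a, μ.real (D a ∆ (φ ⁻¹' {a})) := measureReal_biUnion_finset_le _ _
      _ ≤ ∑ _a : A, η / (Fintype.card A + 1) := by
          refine Finset.sum_le_sum fun a _ => ?_
          exact ENNReal.toReal_le_of_le_ofReal hη'.le (hDμ a).le
      _ = Fintype.card A * (η / (Fintype.card A + 1)) := by simp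
      _ < (Fintype.card A + 1) * (η / (Fintype.card A + 1)) := by gcongr; linarith
      _ = η := by field_simp

theorem pi_eq_generateFrom_isLocal {Γ B : Type*} [Finite B] [MeasurableSpace B]
    [MeasurableSingletonClass B] :
    (MeasurableSpace.pi : MeasurableSpace (Γ → B)) =
      MeasurableSpace.generateFrom {E | ∃ W : Finset Γ, IsLocal W E} := by
  refine le_antisymm ?_ (MeasurableSpace.generateFrom_le ?_)
  · refine iSup_le fun g => ?_
    rintro _ ⟨s, -, rfl⟩
    refine MeasurableSpace.measurableSet_generateFrom ⟨{g}, fun a b hab ha => ?_⟩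
    have : a g = b g := hab g (by simp)
    simpa [← this] using ha
  · rintro E ⟨W, hE⟩
    exact hE.measurableSet

theorem equivariantMap_shiftSystem_eval_one {Γ : Type*} [Group Γ] {B : Type*} [MeasurableSpace B]
    {ν : Measure (Γ → B)} (hν : IsShiftInvariant ν) (x : Γ → B) :
    equivariantMap (shiftSystem hν) (fun a : Γ → B => a 1) x = x := by
  funext g
  simp [equivariantMap, shiftSystem, shift]

/-- Microstates model the coordinate at `1`, hence all its block codes, and these are dense in
measure among finite-valued maps. -/
theorem HasMicrostates.allModels {Γ : Type*} [Group Γ] [Countable Γ] {V : ℕ → Type*}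
    [∀ n, Fintype (V n)] [∀ n, Nonempty (V n)] {σ : ∀ n, Γ →* Equiv.Perm (V n)}
    {B : Type*} [Finite B] [TopologicalSpace B] [DiscreteTopology B]
    [MeasurableSpace B] [BorelSpace B] {ν : ProbabilityMeasure (Γ → B)}
    (h : HasMicrostates (fun n => ⇑(σ n)) ν) (hν : IsShiftInvariant (ν : Measure (Γ → B))) :
    AllModels σ (shiftSystem hν) := by
  classical
  intro m φ hφ
  have hbase : HasModels σ (shiftSystem hν) (fun a : Γ → B => a 1) := by
    refine h.hasModels (measurable_pi_apply 1) ?_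
    have : equivariantMap (shiftSystem hν) (fun a : Γ → B => a 1) = id :=
      funext (equivariantMap_shiftSystem_eval_one hν)
    rw [this, Measure.map_id]
  refine HasModels.of_approx hφ fun η hη => ?_
  obtain ⟨t, φ', ht, hφ', hdet, hdist⟩ := exists_approx_of_generateFrom
    (μ := (ν : Measure (Γ → B))) pi_eq_generateFrom_isLocal hφ hη
  refine ⟨φ', hφ', ?_, hdist⟩
  choose! W hW using ht
  have hdep : DependsOn φ' (t.biUnion W : Set Γ) := by
    intro a b hab
    refine hdet a b fun C hC => ⟨hW hC fun g hg => hab g ?_, hW hC fun g hg => (hab g ?_).symm⟩ <;>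
    exact Finset.mem_coe.2 (Finset.mem_biUnion.2 ⟨C, hC, hg⟩)
  have := hbase.blockCode hdep
  simpa only [equivariantMap_shiftSystem_eval_one] using this

theorem prod_pi_eq_generateFrom {Γ Y K : Type*} [Nonempty Γ] [MeasurableSpace Y]
    [MeasurableSpace K] :
    (Prod.instMeasurableSpace : MeasurableSpace (Y × (Γ → K))) =
      MeasurableSpace.generateFrom {E | ∃ (C : Set Y) (g : Γ) (D : Set K), MeasurableSet C ∧
        MeasurableSet D ∧ E = {p | p.1 ∈ C ∧ p.2 g ∈ D}} := by
  refine le_antisymm (sup_le ?_ ?_) (MeasurableSpace.generateFrom_le ?_)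
  · rintro _ ⟨C, hC, rfl⟩
    refine MeasurableSpace.measurableSet_generateFrom
      ⟨C, Classical.arbitrary Γ, Set.univ, hC, MeasurableSet.univ, ?_⟩
    ext p
    simp
  · rw [MeasurableSpace.pi, MeasurableSpace.comap_iSup]
    refine iSup_le fun g => ?_
    rintro _ ⟨_, ⟨D, hD, rfl⟩, rfl⟩
    refine MeasurableSpace.measurableSet_generateFrom ⟨Set.univ, g, D, MeasurableSet.univ, hD, ?_⟩
    ext p
    simp
  · rintro _ ⟨C, g, D, hC, hD, rfl⟩
    exact (measurable_fst hC).inter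
      (((measurable_pi_apply g).comp measurable_snd) hD)

/-- A finite-valued measurable map on `Y × K^Γ` is close in measure to one that depends on finite
partitions of `Y` and `K` and on finitely many coordinates in `Γ`. -/
theorem exists_approx_prod_pi {Γ Y K : Type*} [Nonempty Γ] [MeasurableSpace Y]
    [MeasurableSpace K] {μ : Measure (Y × (Γ → K))} [IsProbabilityMeasure μ]
    {A : Type*} [Finite A] [MeasurableSpace A] [MeasurableSingletonClass A]
    {φ : Y × (Γ → K) → A} (hφ : Measurable φ) {η : ℝ} (hη : 0 < η) :
    ∃ (s : Finset (Set Y)) (W : Finset Γ) (t : Finset (Set K)) (φ' : Y × (Γ → K) → A),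
      (∀ C ∈ s, MeasurableSet C) ∧ (∀ D ∈ t, MeasurableSet D) ∧ Measurable φ' ∧
      (∀ p p', (∀ C ∈ s, (p.1 ∈ C ↔ p'.1 ∈ C)) →
        (∀ g ∈ W, ∀ D ∈ t, (p.2 g ∈ D ↔ p'.2 g ∈ D)) → φ' p = φ' p') ∧
      μ.real {p | φ p ≠ φ' p} < η := by
  classical
  obtain ⟨u, φ', hu, hφ', hdet, hdist⟩ := exists_approx_of_generateFrom (μ := μ)
    prod_pi_eq_generateFrom hφ hη
  choose! C g D hC hD hE using hu
  refine ⟨u.image C, u.image g, u.image D, φ', ?_, ?_, hφ', ?_, hdist⟩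
  · simp only [Finset.forall_mem_image]
    exact fun E hEu => hC hEu
  · simp only [Finset.forall_mem_image]
    exact fun E hEu => hD hEu
  · intro p p' h₁ h₂
    refine hdet p p' fun E hEu => ?_
    rw [hE hEu]
    exact and_congr (h₁ _ (Finset.mem_image_of_mem _ hEu))
      (h₂ _ (Finset.mem_image_of_mem _ hEu) _ (Finset.mem_image_of_mem _ hEu))

/-! ### Random labellings -/

section RandomLabelling

set_option linter.unusedSectionVars false

variable {V ι K : Type*} [Fintype V] [MeasurableSpace K] {κ : Measure K} [IsProbabilityMeasure κ]

/-- The labellings of `V` that carry the pattern `R` at the point `v`. -/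
def patternAt (W : Finset ι) (s : ι → Equiv.Perm V) (R : ι → Set K) (v : V) : Set (V → K) :=
  {k | ∀ g ∈ W, k (s g v) ∈ R g}

/-- Writing the event as a box over the sites `u` makes product measure applicable even when several
`g` move `v` to the same site. -/
theorem patternAt_eq_pi (W : Finset ι) (s : ι → Equiv.Perm V) (R : ι → Set K) (v : V) :
    patternAt W s R v = Set.univ.pi fun u => ⋂ g ∈ W, ⋂ _ : s g v = u, R g := by
  ext k
  simp only [patternAt, Set.mem_ofPred_eq, Set.mem_univ_pi, Set.mem_iInter]
  exact ⟨fun h u g hg hu => hu ▸ h g hg, fun h g hg => h _ g hg rfl⟩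

theorem measurableSet_patternAt (W : Finset ι) (s : ι → Equiv.Perm V) {R : ι → Set K}
    (hR : ∀ g, MeasurableSet (R g)) (v : V) : MeasurableSet (patternAt W s R v) := by
  rw [patternAt_eq_pi]
  exact MeasurableSet.univ_pi fun u => Finset.measurableSet_biInter _ fun g _ =>
    MeasurableSet.iInter fun _ => hR g

/-- Injectivity puts the constraints on distinct sites, where the labels are independent. -/
theorem pi_patternAt {W : Finset ι} {s : ι → Equiv.Perm V} (R : ι → Set K) {v : V}
    (hv : Set.InjOn (fun g => s g v) W) :
    (Measure.pi fun _ : V => κ) (patternAt W s R v) = ∏ g ∈ W, κ (R g) := by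
  classical
  rw [patternAt_eq_pi, Measure.pi_pi,
    ← Finset.prod_subset (Finset.subset_univ (W.image fun g => s g v)),
    Finset.prod_image hv]
  · refine Finset.prod_congr rfl fun g hg => ?_
    congr 1
    refine Set.Subset.antisymm (fun x hx => ?_) (fun x hx => ?_)
    · simp only [Set.mem_iInter] at hx
      exact hx g hg rfl
    · simp only [Set.mem_iInter]
      intro h hh hgh
      rwa [hv hh hg hgh]
  · intro u _ hu
    have : (⋂ g ∈ W, ⋂ _ : s g v = u, R g) = Set.univ := by
      simp only [Set.iInter_eq_univ]
      intro g hg hgu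
      exact absurd (Finset.mem_image.2 ⟨g, hg, hgu⟩) hu
    rw [this, measure_univ]

theorem pi_patternAt_inter {W : Finset ι} {s : ι → Equiv.Perm V} (R : ι → Set K) {v v' : V}
    (h : ∀ g ∈ W, ∀ g' ∈ W, s g v ≠ s g' v') :
    (Measure.pi fun _ : V => κ) (patternAt W s R v ∩ patternAt W s R v') =
      (Measure.pi fun _ : V => κ) (patternAt W s R v) *
        (Measure.pi fun _ : V => κ) (patternAt W s R v') := by
  simp only [patternAt_eq_pi, ← Set.pi_inter_distrib, Measure.pi_pi, ← Finset.prod_mul_distrib]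
  refine Finset.prod_congr rfl fun u _ => ?_
  by_cases hu : ∃ g ∈ W, s g v = u
  · obtain ⟨g, hg, rfl⟩ := hu
    have : (⋂ g' ∈ W, ⋂ _ : s g' v' = s g v, R g') = Set.univ := by
      simp only [Set.iInter_eq_univ]
      intro g' hg' hgu
      exact absurd hgu.symm (h g hg g' hg')
    rw [this, Set.inter_univ, measure_univ, mul_one]
  · have : (⋂ g ∈ W, ⋂ _ : s g v = u, R g) = Set.univ := by
      simp only [Set.iInter_eq_univ]
      intro g hg hgu
      exact absurd ⟨g, hg, hgu⟩ hu
    rw [this, Set.univ_inter, measure_univ, one_mul]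

/-- The centred indicator function of the pattern `R` at `v`. -/
noncomputable def centredPattern (κ : Measure K) (W : Finset ι) (s : ι → Equiv.Perm V)
    (R : ι → Set K) (v : V) (k : V → K) : ℝ :=
  (patternAt W s R v).indicator 1 k - ∏ g ∈ W, κ.real (R g)

theorem prod_measureReal_mem_Icc (W : Finset ι) (R : ι → Set K) :
    ∏ g ∈ W, κ.real (R g) ∈ Set.Icc (0 : ℝ) 1 :=
  ⟨Finset.prod_nonneg fun _ _ => measureReal_nonneg,
    Finset.prod_le_one (fun _ _ => measureReal_nonneg) fun _ _ => measureReal_le_one⟩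

theorem abs_centredPattern_le (W : Finset ι) (s : ι → Equiv.Perm V) (R : ι → Set K) (v : V)
    (k : V → K) : |centredPattern κ W s R v k| ≤ 1 := by
  have := prod_measureReal_mem_Icc (κ := κ) W R
  unfold centredPattern
  by_cases h : k ∈ patternAt W s R v
  · rw [Set.indicator_of_mem h, Pi.one_apply, abs_le]
    exact ⟨by linarith [this.2], by linarith [this.1]⟩
  · rw [Set.indicator_of_notMem h, abs_le]
    exact ⟨by linarith [this.2], by linarith [this.1]⟩

theorem measurable_centredPattern (W : Finset ι) (s : ι → Equiv.Perm V) {R : ι → Set K}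
    (hR : ∀ g, MeasurableSet (R g)) (v : V) : Measurable (centredPattern κ W s R v) :=
  (measurable_one.indicator (measurableSet_patternAt W s hR v)).sub_const _

theorem integrable_centredPattern_mul (W : Finset ι) (s : ι → Equiv.Perm V) {R : ι → Set K}
    (hR : ∀ g, MeasurableSet (R g)) (v v' : V) :
    Integrable (fun k => centredPattern κ W s R v k * centredPattern κ W s R v' k)
      (Measure.pi fun _ : V => κ) := by
  refine Integrable.of_bound (C := 1) ((measurable_centredPattern W s hR v).mul
    (measurable_centredPattern W s hR v')).aestronglyMeasurable (Eventually.of_forall fun k => ?_)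
  rw [norm_mul, Real.norm_eq_abs, Real.norm_eq_abs]
  exact mul_le_one₀ (abs_centredPattern_le W s R v k) (abs_nonneg _)
    (abs_centredPattern_le W s R v' k)

theorem integral_centredPattern_mul_le (W : Finset ι) (s : ι → Equiv.Perm V) {R : ι → Set K}
    (hR : ∀ g, MeasurableSet (R g)) (v v' : V) :
    ∫ k, centredPattern κ W s R v k * centredPattern κ W s R v' k ∂(Measure.pi fun _ : V => κ)
      ≤ 1 := by
  refine (integral_mono (integrable_centredPattern_mul W s hR v v') (integrable_const 1)
    fun k => ?_).trans_eq (by simp)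
  refine (le_abs_self _).trans ?_
  rw [abs_mul]
  exact mul_le_one₀ (abs_centredPattern_le W s R v k) (abs_nonneg _)
    (abs_centredPattern_le W s R v' k)

theorem integral_centredPattern_mul_eq_zero {W : Finset ι} {s : ι → Equiv.Perm V} {R : ι → Set K}
    (hR : ∀ g, MeasurableSet (R g)) {v v' : V} (hv : Set.InjOn (fun g => s g v) W)
    (hv' : Set.InjOn (fun g => s g v') W) (h : ∀ g ∈ W, ∀ g' ∈ W, s g v ≠ s g' v') :
    ∫ k, centredPattern κ W s R v k * centredPattern κ W s R v' k ∂(Measure.pi fun _ : V => κ)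
      = 0 := by
  set P := Measure.pi fun _ : V => κ
  set c := ∏ g ∈ W, κ.real (R g) with hc
  have hD := measurableSet_patternAt W s hR v
  have hD' := measurableSet_patternAt W s hR v'
  have hPD : P.real (patternAt W s R v) = c := by
    rw [measureReal_def, pi_patternAt R hv, ENNReal.toReal_prod, hc]
    rfl
  have hPD' : P.real (patternAt W s R v') = c := by
    rw [measureReal_def, pi_patternAt R hv', ENNReal.toReal_prod, hc]
    rfl
  have hint : ∀ D : Set (V → K), MeasurableSet D →
      Integrable (fun k => D.indicator (1 : (V → K) → ℝ) k) P :=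
    fun D hD => (integrable_const (1 : ℝ)).indicator hD
  have hexp : (fun k => centredPattern κ W s R v k * centredPattern κ W s R v' k) = fun k =>
      (patternAt W s R v ∩ patternAt W s R v').indicator (1 : (V → K) → ℝ) k
        - c * (patternAt W s R v).indicator 1 k - c * (patternAt W s R v').indicator 1 k
        + c * c := by
    funext k
    rw [Set.inter_indicator_one, Pi.mul_apply]
    simp only [centredPattern]
    ring
  have i₁ := hint _ (hD.inter hD')
  have i₂ := (hint _ hD).const_mul c
  have i₃ := (hint _ hD').const_mul c
  have i₁₂ : Integrable (fun k => (patternAt W s R v ∩ patternAt W s R v').indicator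
      (1 : (V → K) → ℝ) k - c * (patternAt W s R v).indicator 1 k) P := i₁.sub i₂
  have i₁₂₃ : Integrable (fun k => (patternAt W s R v ∩ patternAt W s R v').indicator
      (1 : (V → K) → ℝ) k - c * (patternAt W s R v).indicator 1 k
      - c * (patternAt W s R v').indicator 1 k) P := i₁₂.sub i₃
  rw [hexp, integral_add i₁₂₃ (integrable_const _), integral_sub i₁₂ i₃, integral_sub i₁ i₂, integral_const_mul, integral_const_mul,
    integral_indicator_one (hD.inter hD'), integral_indicator_one hD, integral_indicator_one hD',
    hPD, hPD', measureReal_def, pi_patternAt_inter R h, ENNReal.toReal_mul, ← measureReal_def,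
    ← measureReal_def, hPD, hPD']
  simp

/-- Patterns on disjoint windows are uncorrelated. The window of `v` meets that of `v'` only if `v'`
is one of at most `|W|²` points determined by `v`, so the variance is linear in `|V|` and not
quadratic. -/
theorem integral_sum_centredPattern_sq_le (W : Finset ι) (s : ι → Equiv.Perm V) {R : ι → Set K}
    (hR : ∀ g, MeasurableSet (R g)) {G : Finset V}
    (hG : ∀ v ∈ G, Set.InjOn (fun g => s g v) W) :
    ∫ k, (∑ v ∈ G, centredPattern κ W s R v k) ^ 2 ∂(Measure.pi fun _ : V => κ)
      ≤ (W.card : ℝ) ^ 2 * Fintype.card V := by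
  classical
  simp only [sq (∑ v ∈ G, _), Finset.sum_mul_sum]
  rw [integral_finsetSum _ fun v _ =>
    integrable_finsetSum _ fun v' _ => integrable_centredPattern_mul W s hR v v']
  have hrow : ∀ v ∈ G, ∫ k, ∑ v' ∈ G, centredPattern κ W s R v k * centredPattern κ W s R v' k
      ∂(Measure.pi fun _ : V => κ) ≤ (W.card : ℝ) ^ 2 := by
    intro v hv
    rw [integral_finsetSum _ fun v' _ => integrable_centredPattern_mul W s hR v v']
    set N : Finset V := Finset.image₂ (fun g g' => (s g').symm (s g v)) W W
    calc ∑ v' ∈ G, ∫ k, centredPattern κ W s R v k * centredPattern κ W s R v' k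
          ∂(Measure.pi fun _ : V => κ)
        ≤ ∑ v' ∈ G, if v' ∈ N then (1 : ℝ) else 0 := by
          refine Finset.sum_le_sum fun v' hv' => ?_
          split_ifs with hN
          · exact integral_centredPattern_mul_le W s hR v v'
          · refine (integral_centredPattern_mul_eq_zero hR (hG v hv) (hG v' hv') ?_).le
            intro g hg g' hg' hgg'
            refine hN (Finset.mem_image₂.2 ⟨g, hg, g', hg', ?_⟩)
            rw [hgg', Equiv.symm_apply_apply]
      _ ≤ (N.card : ℝ) := by
          rw [Finset.sum_boole]
          exact_mod_cast Finset.card_le_card fun v' hv' => (Finset.mem_filter.1 hv').2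
      _ ≤ (W.card : ℝ) ^ 2 := by
          rw [sq]
          exact_mod_cast Finset.card_image₂_le _ _ _
  calc _ ≤ ∑ v ∈ G, (W.card : ℝ) ^ 2 := Finset.sum_le_sum hrow
    _ = G.card * (W.card : ℝ) ^ 2 := by simp
    _ ≤ Fintype.card V * (W.card : ℝ) ^ 2 := by
      gcongr
      exact Finset.card_le_univ G
    _ = _ := mul_comm _ _

/-- A labelling at which the sum over `I` of the squares is at most its mean controls all patterns
at once. -/
theorem exists_forall_sum_centredPattern_sq_le {I : Type*} [Fintype I] (W : Finset ι)
    (s : ι → Equiv.Perm V) {R : I → ι → Set K} (hR : ∀ i g, MeasurableSet (R i g))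
    {G : I → Finset V} (hG : ∀ i, ∀ v ∈ G i, Set.InjOn (fun g => s g v) W) :
    ∃ k : V → K, ∀ i, (∑ v ∈ G i, centredPattern κ W s (R i) v k) ^ 2
      ≤ Fintype.card I * ((W.card : ℝ) ^ 2 * Fintype.card V) := by
  have hint : ∀ i, Integrable (fun k => (∑ v ∈ G i, centredPattern κ W s (R i) v k) ^ 2)
      (Measure.pi fun _ : V => κ) := by
    intro i
    simp only [sq (∑ v ∈ G i, _), Finset.sum_mul_sum]
    exact integrable_finsetSum _ fun v _ =>
      integrable_finsetSum _ fun v' _ => integrable_centredPattern_mul W s (hR i) v v'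
  obtain ⟨k, hk⟩ := exists_le_integral (μ := Measure.pi fun _ : V => κ)
    (integrable_finsetSum Finset.univ fun i _ => hint i)
  refine ⟨k, fun i => ?_⟩
  calc _ ≤ ∑ i, (∑ v ∈ G i, centredPattern κ W s (R i) v k) ^ 2 :=
        Finset.single_le_sum (f := fun i => (∑ v ∈ G i, centredPattern κ W s (R i) v k) ^ 2)
          (fun i _ => sq_nonneg _) (Finset.mem_univ i)
    _ ≤ _ := hk
    _ = ∑ i, ∫ k, (∑ v ∈ G i, centredPattern κ W s (R i) v k) ^ 2
          ∂(Measure.pi fun _ : V => κ) := integral_finsetSum _ fun i _ => hint i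
    _ ≤ ∑ _i : I, (W.card : ℝ) ^ 2 * Fintype.card V :=
        Finset.sum_le_sum fun i _ => integral_sum_centredPattern_sq_le W s (hR i) (hG i)
    _ = _ := by simp

theorem freq_eq_sum (P : Set V) [DecidablePred (· ∈ P)] :
    freq P = (∑ v, if v ∈ P then (1 : ℝ) else 0) / Fintype.card V := by
  rw [freq, Finset.sum_boole, Set.ncard_eq_toFinset_card']
  congr 2
  congr 1
  ext v
  simp

/-- There is a labelling of `V` for which the frequencies of given patterns on given sets are close
to the expected ones. -/
theorem exists_labelling [Nonempty V] {I : Type*} [Fintype I] (W : Finset ι)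
    (s : ι → Equiv.Perm V) {R : I → ι → Set K} (hR : ∀ i g, MeasurableSet (R i g))
    (G : I → Set V) {η : ℝ} (hη : 0 ≤ η)
    (hcard : Fintype.card I * (W.card : ℝ) ^ 2 ≤ η ^ 2 * Fintype.card V) :
    ∃ k : V → K, ∀ i,
      |freq {v | v ∈ G i ∧ k ∈ patternAt W s (R i) v} - freq (G i) * ∏ g ∈ W, κ.real (R i g)|
        ≤ η + freq {v | ¬ Set.InjOn (fun g => s g v) W} := by
  classical
  -- Points with a non-injective window are left out of the variance bound; each contributes at most
  -- `1` to the error.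
  set bad : Set V := {v | ¬ Set.InjOn (fun g => s g v) W} with hbad
  obtain ⟨k, hk⟩ := exists_forall_sum_centredPattern_sq_le (κ := κ) W s hR
    (G := fun i => (G i \ bad).toFinset) (fun i v hv => by
      have := (Set.mem_toFinset.1 hv).2
      simpa [hbad] using this)
  refine ⟨k, fun i => ?_⟩
  have hVpos : (0 : ℝ) < Fintype.card V := by exact_mod_cast Fintype.card_pos
  set f := fun v => centredPattern κ W s (R i) v k with hf
  have hsum : freq {v | v ∈ G i ∧ k ∈ patternAt W s (R i) v}
      - freq (G i) * ∏ g ∈ W, κ.real (R i g) = (∑ v ∈ (G i).toFinset, f v) / Fintype.card V := by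
    have : ∑ v ∈ (G i).toFinset, f v = ∑ v, if v ∈ G i then f v else 0 := by
      rw [← Finset.sum_filter]
      congr 1
      ext v
      simp
    rw [freq_eq_sum, freq_eq_sum, this, div_mul_eq_mul_div, ← sub_div, Finset.sum_mul,
      ← Finset.sum_sub_distrib]
    congr 1
    refine Finset.sum_congr rfl fun v _ => ?_
    simp only [hf, centredPattern, Set.mem_ofPred_eq, Set.indicator_apply, Pi.one_apply]
    by_cases h₁ : v ∈ G i <;> by_cases h₂ : k ∈ patternAt W s (R i) v <;> simp [h₁, h₂]
  have hsplit : ∑ v ∈ (G i).toFinset, f v =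
      ∑ v ∈ (G i \ bad).toFinset, f v + ∑ v ∈ (G i ∩ bad).toFinset, f v := by
    rw [← Finset.sum_union]
    · congr 1
      ext v
      simp only [Finset.mem_union, Set.mem_toFinset, Set.mem_sdiff, Set.mem_inter_iff]
      tauto
    · rw [Set.disjoint_toFinset]
      exact Set.disjoint_left.2 fun v h h' => h.2 h'.2
  have h₁ : |∑ v ∈ (G i \ bad).toFinset, f v| ≤ η * Fintype.card V := by
    refine abs_le_of_sq_le_sq ?_ (by positivity)
    calc _ ≤ Fintype.card I * ((W.card : ℝ) ^ 2 * Fintype.card V) := hk i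
      _ = (Fintype.card I * (W.card : ℝ) ^ 2) * Fintype.card V := by ring
      _ ≤ (η ^ 2 * Fintype.card V) * Fintype.card V := by gcongr
      _ = _ := by ring
  have h₂ : |∑ v ∈ (G i ∩ bad).toFinset, f v| ≤ bad.ncard := by
    calc _ ≤ ∑ v ∈ (G i ∩ bad).toFinset, |f v| := Finset.abs_sum_le_sum_abs _ _
      _ ≤ ∑ v ∈ (G i ∩ bad).toFinset, (1 : ℝ) :=
          Finset.sum_le_sum fun v _ => abs_centredPattern_le W s (R i) v k
      _ = (G i ∩ bad).ncard := by rw [Set.ncard_eq_toFinset_card']; simp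
      _ ≤ bad.ncard := by
          exact_mod_cast Set.ncard_le_ncard Set.inter_subset_right
  rw [hsum, hsplit, abs_div, abs_of_pos hVpos, div_le_iff₀ hVpos, add_mul, freq,
    div_mul_cancel₀ _ hVpos.ne']
  exact (abs_add_le _ _).trans (add_le_add h₁ h₂)

end RandomLabelling

/-! ### Models of products with Bernoulli shifts -/

section Sofic

variable {Γ : Type*} [Group Γ] {V : ℕ → Type*} [∀ n, Fintype (V n)] {σ : ∀ n, Γ →* Equiv.Perm (V n)}

/-- If distinct `g`, `h` give `σ n g⁻¹ v = σ n h⁻¹ v`, then `σ n (h * g⁻¹)` fixes `v`; asymptotic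
freeness applies to each of the finitely many pairs. -/
theorem tendsto_freq_not_injOn (hσ : IsSoficApproximation fun n => ⇑(σ n)) (W : Finset Γ) :
    Tendsto (fun n => freq {v | ¬ Set.InjOn (fun g => σ n g⁻¹ v) W}) atTop (𝓝 0) := by
  classical
  have hlim : Tendsto (fun n => ∑ p ∈ W.offDiag, freq {v | σ n (p.2 * p.1⁻¹) v = v}) atTop
      (𝓝 0) := by
    rw [← Finset.sum_const_zero (s := W.offDiag)]
    refine tendsto_finsetSum _ fun p hp => hσ.2 _ fun h => ?_
    rw [mul_inv_eq_one] at h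
    exact (Finset.mem_offDiag.1 hp).2.2 h.symm
  refine squeeze_zero (fun _ => freq_nonneg _) (fun n => ?_) hlim
  refine (freq_mono ?_).trans (freq_biUnion_le _ _)
  intro v hv
  simp only [Set.mem_ofPred_eq, Set.InjOn, not_forall] at hv
  obtain ⟨g, hg, h, hh, hgh, hne⟩ := hv
  refine Set.mem_biUnion (x := (g, h)) (Finset.mem_coe.2 (Finset.mem_offDiag.2 ⟨hg, hh, hne⟩)) ?_
  simp only [Set.mem_ofPred_eq, map_mul, Equiv.Perm.mul_apply]
  rw [hgh, ← Equiv.Perm.mul_apply, ← map_mul, mul_inv_cancel, map_one, Equiv.Perm.one_apply]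

/-- For infinite `Γ`, a window of `M` elements eventually embeds into `V n` through the orbit map of
some point. -/
theorem tendsto_card_atTop [∀ n, Nonempty (V n)] (hσ : IsSoficApproximation fun n => ⇑(σ n))
    (hV : Finite Γ → Tendsto (fun n => Fintype.card (V n)) atTop atTop) :
    Tendsto (fun n => Fintype.card (V n)) atTop atTop := by
  rcases finite_or_infinite Γ with hΓ | hΓ
  · exact hV hΓ
  refine tendsto_atTop.2 fun M => ?_
  obtain ⟨W, rfl⟩ := Infinite.exists_subset_card_eq Γ M
  filter_upwards [(tendsto_freq_not_injOn hσ W).eventually_lt_const one_pos] with n hn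
  obtain ⟨v, hv⟩ : ∃ v, Set.InjOn (fun g => σ n g⁻¹ v) W := by
    by_contra! hcon
    have : {v | ¬ Set.InjOn (fun g => σ n g⁻¹ v) W} = Set.univ := Set.eq_univ_of_forall hcon
    rw [this, freq_univ] at hn
    exact lt_irrefl _ hn
  exact (Finset.card_le_card_of_injOn _ (fun _ _ => Finset.mem_univ _) hv).trans_eq
    Finset.card_univ

end Sofic

theorem abs_freq_sub_measureReal_le {V X P : Type*} [Fintype V] [MeasurableSpace X] [Fintype P]
    {θ : Measure X} [IsFiniteMeasure θ] {u : V → P} {w : X → P}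
    (hw : ∀ p, MeasurableSet (w ⁻¹' {p})) {η : ℝ}
    (h : ∀ p, |freq {v | u v = p} - θ.real (w ⁻¹' {p})| ≤ η) (E : Set P) :
    |freq {v | u v ∈ E} - θ.real (w ⁻¹' E)| ≤ Fintype.card P * η := by
  classical
  have hη : ∀ p : P, 0 ≤ η := fun p => (abs_nonneg _).trans (h p)
  have h₁ : freq {v | u v ∈ E} = ∑ p ∈ E.toFinset, freq {v | u v = p} := by
    simp only [freq_eq_sum, ← Finset.sum_div]
    rw [Finset.sum_comm]
    congr 1
    refine Finset.sum_congr rfl fun v _ => ?_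
    simp
  have h₂ : θ.real (w ⁻¹' E) = ∑ p ∈ E.toFinset, θ.real (w ⁻¹' {p}) := by
    rw [sum_measureReal_preimage_singleton _ fun p _ => hw p, Set.coe_toFinset]
  rw [h₁, h₂, ← Finset.sum_sub_distrib]
  calc _ ≤ ∑ p ∈ E.toFinset, |freq {v | u v = p} - θ.real (w ⁻¹' {p})| :=
        Finset.abs_sum_le_sum_abs _ _
    _ ≤ ∑ p ∈ E.toFinset, η := Finset.sum_le_sum fun p _ => h p
    _ ≤ ∑ p, η := Finset.sum_le_sum_of_subset_of_nonneg (Finset.subset_univ _) fun p _ _ => hη p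
    _ = _ := by simp

section Product

set_option linter.unusedSectionVars false

variable {Γ : Type*} [Group Γ] [Countable Γ] {V : ℕ → Type*} [∀ n, Fintype (V n)]
  [∀ n, Nonempty (V n)] {σ : ∀ n, Γ →* Equiv.Perm (V n)}
  {Y : Type*} [MeasurableSpace Y] {θ : Measure Y} [IsProbabilityMeasure θ] {S : PMPAction Γ θ}
  {K : Type*} [MeasurableSpace K] {κ : Measure K} [IsProbabilityMeasure κ]

theorem equivariantMap_prod_bernoulliShift {B L : Type*} (β : Y → B) (q : K → L)
    (p : Y × (Γ → K)) (g : Γ) :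
    equivariantMap (S.prod (bernoulliShift Γ κ)) (fun p => (β p.1, q (p.2 1))) p g =
      (equivariantMap S β p.1 g, q (p.2 g)) := by
  simp [equivariantMap, PMPAction.prod, bernoulliShift, shiftSystem, shift]

/-- The model keeps the labelling `b` for `β` and adds a labelling `k` by points of `K`. On the set
of points where `b` shows a given pattern, `k` shows each pattern with nearly its Bernoulli
frequency, so joint frequencies nearly factorize. -/
theorem HasModels.prod_bernoulliShift (hσ : IsSoficApproximation fun n => ⇑(σ n))
    (hcard : Tendsto (fun n => Fintype.card (V n)) atTop atTop)
    {B L : Type*} [Finite B] [MeasurableSpace B] [MeasurableSingletonClass B]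
    [Finite L] [MeasurableSpace L] [MeasurableSingletonClass L]
    {β : Y → B} (hβm : Measurable β) (hβ : HasModels σ S β) {q : K → L} (hq : Measurable q) :
    HasModels σ (S.prod (bernoulliShift Γ κ)) (fun p => (β p.1, q (p.2 1))) := by
  classical
  intro W η hη
  cases nonempty_fintype B
  cases nonempty_fintype L
  set N : ℝ := ((Fintype.card (W → B × L) : ℕ) : ℝ) with hN
  have hN0 : 0 ≤ N := Nat.cast_nonneg _
  -- Each of the `N` patterns costs `η'` for the model of `β`, `η'` for the random labelling and
  -- `η'` for non-injective windows; the `+ 1` makes the final inequality strict.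
  set η' := η / (3 * N + 1) with hη'
  have hη'0 : 0 < η' := by positivity
  let R : (W → B × L) → Γ → Set K := fun p g =>
    if h : g ∈ W then q ⁻¹' {(p ⟨g, h⟩).2} else Set.univ
  have hR : ∀ p g, MeasurableSet (R p g) := fun p g => by
    simp only [R]
    split_ifs
    · exact hq (measurableSet_singleton _)
    · exact MeasurableSet.univ
  let T : (W → B × L) → Set (Γ → B) := fun p => {c | ∀ g : W, c g = (p g).1}
  have hT : ∀ p, IsLocal W (T p) := fun p a b hab ha g => (hab g g.2).symm.trans (ha g)
  have hlarge : ∀ᶠ n in atTop, N * (W.card : ℝ) ^ 2 ≤ η' ^ 2 * Fintype.card (V n) :=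
    (Tendsto.const_mul_atTop (by positivity : (0 : ℝ) < η' ^ 2)
      (tendsto_natCast_atTop_atTop.comp hcard)).eventually_ge_atTop _
  filter_upwards [hβ W η' hη'0, hlarge,
    (tendsto_freq_not_injOn hσ W).eventually_lt_const hη'0] with n hn hlarge hbad
  obtain ⟨b, hb⟩ := hn
  obtain ⟨k, hk⟩ := exists_labelling (κ := κ) W (fun g => σ n g⁻¹) hR
    (fun p => {v | pullbackName (σ n) b v ∈ T p}) hη'0.le hlarge
  refine ⟨fun v => (b v, q (k v)), fun E hE => ?_⟩
  set w : Y × (Γ → K) → W → B × L := fun p => W.restrict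
    (equivariantMap (S.prod (bernoulliShift Γ κ)) (fun p => (β p.1, q (p.2 1))) p) with hw
  have hwm : Measurable w := (W.measurable_restrict).comp (measurable_equivariantMap _
    ((hβm.comp measurable_fst).prodMk (hq.comp ((measurable_pi_apply 1).comp measurable_snd))))
  have hpat : ∀ p, |freq {v | W.restrict (pullbackName (σ n) (fun v => (b v, q (k v))) v) = p}
      - (θ.prod (bernoulliMeasure Γ κ)).real (w ⁻¹' {p})| ≤ 3 * η' := by
    intro p
    have h₁ : {v | W.restrict (pullbackName (σ n) (fun v => (b v, q (k v))) v) = p} =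
        {v | v ∈ {v | pullbackName (σ n) b v ∈ T p} ∧
          k ∈ patternAt W (fun g => σ n g⁻¹) (R p) v} := by
      ext v
      simp only [Set.mem_ofPred_eq, funext_iff, Finset.restrict, pullbackName, T, patternAt, R,
        Prod.ext_iff, forall_and]
      refine and_congr_right fun _ => ⟨fun h g hg => ?_, fun h g => ?_⟩
      · simpa [hg] using h ⟨g, hg⟩
      · simpa using h g g.2
    have h₂ : w ⁻¹' {p} = {y | equivariantMap S β y ∈ T p} ×ˢ (W : Set Γ).pi (R p) := by
      ext ⟨y, z⟩
      simp only [hw, Set.mem_preimage, Set.mem_singleton_iff, funext_iff, Finset.restrict,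
        equivariantMap_prod_bernoulliShift, Set.mem_prod, Set.mem_ofPred_eq, Set.mem_pi, T, R,
        Prod.ext_iff, forall_and]
      refine and_congr_right fun _ => ⟨fun h g hg => ?_, fun h g => ?_⟩
      · have hg' : g ∈ W := hg
        simpa [hg'] using h ⟨g, hg'⟩
      · simpa using h g g.2
    have h₃ : (bernoulliMeasure Γ κ).real ((W : Set Γ).pi (R p)) = ∏ g ∈ W, κ.real (R p g) := by
      rw [measureReal_def, bernoulliMeasure, Measure.infinitePi_pi _ fun g _ => hR p g,
        ENNReal.toReal_prod]
      rfl
    rw [h₁, h₂, measureReal_prod_prod, h₃]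
    have hc := prod_measureReal_mem_Icc (κ := κ) W (R p)
    set c := ∏ g ∈ W, κ.real (R p g)
    have e₁ := hk p
    have e₂ := (hb _ (hT p)).le
    have e₃ : |freq {v | pullbackName (σ n) b v ∈ T p} * c -
        θ.real {y | equivariantMap S β y ∈ T p} * c| ≤ η' := by
      rw [← sub_mul, abs_mul, abs_of_nonneg hc.1]
      exact (mul_le_of_le_one_right (abs_nonneg _) hc.2).trans e₂
    refine (abs_sub_le _ (freq {v | pullbackName (σ n) b v ∈ T p} * c) _).trans ?_
    linarith
  have hfinal := abs_freq_sub_measureReal_le (θ := θ.prod (bernoulliMeasure Γ κ))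
    (fun p => hwm (measurableSet_singleton p)) hpat (W.restrict '' E)
  have hEq := hE.eq_preimage
  have hlt : N * (3 * η') < η := by
    rw [hη']
    calc N * (3 * (η / (3 * N + 1))) = (3 * N) * (η / (3 * N + 1)) := by ring
      _ < (3 * N + 1) * (η / (3 * N + 1)) := by gcongr; linarith
      _ = η := by field_simp
  refine lt_of_le_of_lt ?_ hlt
  have e₁ : {v | pullbackName (σ n) (fun v => (b v, q (k v))) v ∈ E} =
      {v | W.restrict (pullbackName (σ n) (fun v => (b v, q (k v))) v) ∈ W.restrict '' E} :=
    Set.ext fun v => Set.ext_iff.1 hEq _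
  have e₂ : {p | equivariantMap (S.prod (bernoulliShift Γ κ)) (fun p => (β p.1, q (p.2 1))) p ∈ E}
      = w ⁻¹' (W.restrict '' E) := Set.ext fun p => Set.ext_iff.1 hEq _
  rw [e₁, e₂]
  exact hfinal

/-- Block codes of pairs of finite partitions of `Y` and `K` are dense in measure, and such pairs
have models by `HasModels.prod_bernoulliShift`. -/
theorem AllModels.prod_bernoulliShift (hσ : IsSoficApproximation fun n => ⇑(σ n))
    (hcard : Tendsto (fun n => Fintype.card (V n)) atTop atTop) (hS : AllModels σ S)
    (κ : Measure K) [IsProbabilityMeasure κ] :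
    AllModels σ (S.prod (bernoulliShift Γ κ)) := by
  classical
  intro m φ hφ
  refine HasModels.of_approx hφ fun η hη => ?_
  obtain ⟨s, W, t, φ', hs, ht, hφ', hdet, hdist⟩ := exists_approx_prod_pi
    (μ := θ.prod (bernoulliMeasure Γ κ)) hφ hη
  refine ⟨φ', hφ', ?_, hdist⟩
  have : Nonempty (Y × (Γ → K)) :=
    nonempty_of_isProbabilityMeasure (θ.prod (bernoulliMeasure Γ κ))
  have : Nonempty (Fin m) := this.map φ
  let β : Y → s → Prop := fun y C => y ∈ C.1
  let q : K → t → Prop := fun k D => k ∈ D.1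
  have hβ : Measurable β :=
    measurable_pi_lambda _ fun C => measurableSet_setOfPred.1 (hs C.1 C.2)
  have hq : Measurable q :=
    measurable_pi_lambda _ fun D => measurableSet_setOfPred.1 (ht D.1 D.2)
  obtain ⟨F, hF⟩ := (Function.factorsThrough_iff φ').1 (show Function.FactorsThrough φ'
      (fun p => (β p.1, fun g : W => q (p.2 g))) from by
    intro p p' hpp'
    obtain ⟨h₁, h₂⟩ := Prod.ext_iff.1 hpp'
    refine hdet p p' (fun C hC => ?_) (fun g hg D hD => ?_)
    · exact iff_of_eq (congrFun h₁ ⟨C, hC⟩)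
    · exact iff_of_eq (congrFun (congrFun h₂ ⟨g, hg⟩) ⟨D, hD⟩))
  -- The partition of `Y` is read at the identity only, so `1` has to be added to the window.
  let f : (Γ → (s → Prop) × (t → Prop)) → Fin m := fun c => F ((c 1).1, fun g : W => (c g).2)
  have hf : DependsOn f (insert 1 W : Finset Γ) := by
    intro c d hcd
    simp only [f]
    rw [hcd 1 (by simp)]
    congr 2
    funext g
    rw [hcd g (by simp)]
  refine (((hS.hasModels hβ).prod_bernoulliShift (κ := κ) hσ hcard hβ hq).blockCode hf).congr_ae ?_
  filter_upwards [Measure.quasiMeasurePreserving_fst.ae S.act_one] with p hp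
  simp only [f, equivariantMap_prod_bernoulliShift, hF, Function.comp]
  simp only [equivariantMap, inv_one, hp, id]

end Product

/-! ### Resampling the Bernoulli coordinate step by step -/

section Mix

variable {Γ K : Type*}

/-- Take the entries of `z'` on `U` and those of `z` elsewhere. -/
noncomputable def mixOn (U : Set Γ) (z z' : Γ → K) : Γ → K :=
  open Classical in fun g => if g ∈ U then z' g else z g

/-- Each coordinate is taken from exactly one of two independent samples, so the mixture is again
i.i.d. -/
theorem measurePreserving_mixOn [MeasurableSpace K] {κ : Measure K} [IsProbabilityMeasure κ]
    (U : Set Γ) :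
    MeasurePreserving (fun p : (Γ → K) × (Γ → K) => mixOn U p.1 p.2)
      ((bernoulliMeasure Γ κ).prod (bernoulliMeasure Γ κ)) (bernoulliMeasure Γ κ) := by
  classical
  have hm : Measurable (fun p : (Γ → K) × (Γ → K) => mixOn U p.1 p.2) := by
    refine measurable_pi_lambda _ fun g => ?_
    by_cases hg : g ∈ U
    · simp only [mixOn, if_pos hg]
      fun_prop
    · simp only [mixOn, if_neg hg]
      fun_prop
  refine ⟨hm, Measure.eq_infinitePi _ fun s t ht => ?_⟩
  rw [Measure.map_apply hm (MeasurableSet.pi s.countable_toSet fun g _ => ht g)]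
  have : (fun p : (Γ → K) × (Γ → K) => mixOn U p.1 p.2) ⁻¹' ((s : Set Γ).pi t) =
      ((s.filter fun g => g ∉ U : Finset Γ) : Set Γ).pi t ×ˢ
        ((s.filter fun g => g ∈ U : Finset Γ) : Set Γ).pi t := by
    ext p
    simp only [Set.mem_preimage, Set.mem_pi, Set.mem_prod, Finset.coe_filter, Set.mem_ofPred_eq,
      Finset.mem_coe]
    refine ⟨fun h => ⟨fun g hg => ?_, fun g hg => ?_⟩, fun h g hg => ?_⟩
    · simpa [mixOn, hg.2] using h g hg.1
    · simpa [mixOn, hg.2] using h g hg.1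
    · by_cases hgU : g ∈ U
      · simpa [mixOn, hgU] using h.2 g ⟨hg, hgU⟩
      · simpa [mixOn, hgU] using h.1 g ⟨hg, hgU⟩
  rw [this, Measure.prod_prod, bernoulliMeasure, Measure.infinitePi_pi _ fun g _ => ht g,
    Measure.infinitePi_pi _ fun g _ => ht g, mul_comm,
    Finset.prod_filter_mul_prod_filter_not s (fun g => g ∈ U)]

variable {Y : Type*} {N : ℕ}

/-- In the Bernoulli coordinate, take the entries of the second sample where the clock `p.2` is
less than `j`, and those of the first sample elsewhere. -/
noncomputable def resample (j : ℕ) (p : ((Y × (Γ → K)) × (Γ → K)) × (Γ → Fin N)) : Y × (Γ → K) :=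
  (p.1.1.1, mixOn {g | (p.2 g : ℕ) < j} p.1.1.2 p.1.2)

theorem resample_zero (p : ((Y × (Γ → K)) × (Γ → K)) × (Γ → Fin N)) :
    resample 0 p = p.1.1 := by
  refine Prod.ext rfl (funext fun g => ?_)
  simp [resample, mixOn]

theorem resample_last (p : ((Y × (Γ → K)) × (Γ → K)) × (Γ → Fin N)) :
    resample N p = (p.1.1.1, p.1.2) := by
  refine Prod.ext rfl (funext fun g => ?_)
  simp [resample, mixOn]

variable [MeasurableSpace K] [MeasurableSpace Y]

theorem measurable_resample (j : ℕ) :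
    Measurable (resample j : ((Y × (Γ → K)) × (Γ → K)) × (Γ → Fin N) → Y × (Γ → K)) := by
  classical
  refine (measurable_fst.comp (measurable_fst.comp measurable_fst)).prodMk
    (measurable_pi_lambda _ fun g => ?_)
  simp only [mixOn]
  refine Measurable.ite ?_ ((measurable_pi_apply g).comp (measurable_snd.comp measurable_fst))
    ((measurable_pi_apply g).comp (measurable_snd.comp (measurable_fst.comp measurable_fst)))
  have hg : Measurable fun p : ((Y × (Γ → K)) × (Γ → K)) × (Γ → Fin N) => p.2 g :=
    (measurable_pi_apply g).comp measurable_snd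
  exact hg (Set.toFinite {i : Fin N | (i : ℕ) < j}).measurableSet

/-- With the clock frozen this is `measurePreserving_mixOn`; the result is then averaged over the
clock. -/
theorem measurePreserving_resample {θ : Measure Y} [IsProbabilityMeasure θ]
    {κ : Measure K} [IsProbabilityMeasure κ] {τ : Measure (Fin N)} [IsProbabilityMeasure τ]
    (j : ℕ) :
    MeasurePreserving (resample j)
      (((θ.prod (bernoulliMeasure Γ κ)).prod (bernoulliMeasure Γ κ)).prod (bernoulliMeasure Γ τ))
      (θ.prod (bernoulliMeasure Γ κ)) := by
  refine ⟨measurable_resample j, Measure.ext fun D hD => ?_⟩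
  rw [Measure.map_apply (measurable_resample j) hD,
    Measure.prod_apply_symm (measurable_resample j hD)]
  have hfix : ∀ u : Γ → Fin N, ((θ.prod (bernoulliMeasure Γ κ)).prod (bernoulliMeasure Γ κ))
      ((fun x => (x, u)) ⁻¹' (resample j ⁻¹' D)) = (θ.prod (bernoulliMeasure Γ κ)) D := by
    intro u
    have h := ((MeasurePreserving.id θ).prod
      (measurePreserving_mixOn (κ := κ) {g | (u g : ℕ) < j})).comp
      (measurePreserving_prodAssoc θ (bernoulliMeasure Γ κ) (bernoulliMeasure Γ κ))
    exact h.measure_preimage hD.nullMeasurableSet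
  simp [hfix]

/-- Steps `j` and `j + 1` differ only at sites whose clock equals `j`. An approximation of `φ` with
window `W` sees such a site with probability at most `|W|` divided by the number of clock values. -/
theorem exists_resample_step_lt {θ : Measure Y} [IsProbabilityMeasure θ]
    {κ : Measure K} [IsProbabilityMeasure κ] {A : Type*} [Finite A] [MeasurableSpace A]
    [MeasurableSingletonClass A] [Nonempty Γ] {φ : Y × (Γ → K) → A} (hφ : Measurable φ)
    {η : ℝ} (hη : 0 < η) :
    ∃ (N : ℕ) (τ : Measure (Fin N)) (_ : IsProbabilityMeasure τ), ∀ j < N,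
      (((θ.prod (bernoulliMeasure Γ κ)).prod (bernoulliMeasure Γ κ)).prod
        (bernoulliMeasure Γ τ)).real {p | φ (resample j p) ≠ φ (resample (j + 1) p)} < η := by
  classical
  obtain ⟨_, W, _, φ', -, -, hφ', hdet, hdist⟩ := exists_approx_prod_pi
    (μ := θ.prod (bernoulliMeasure Γ κ)) hφ (show 0 < η / 3 by positivity)
  obtain ⟨N, hN⟩ := exists_nat_gt (W.card / (η / 3))
  refine ⟨N + 1, (PMF.uniformOfFintype (Fin (N + 1))).toMeasure, inferInstance, fun j hj => ?_⟩
  set τ := (PMF.uniformOfFintype (Fin (N + 1))).toMeasure with hτ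
  set P := (((θ.prod (bernoulliMeasure Γ κ)).prod (bernoulliMeasure Γ κ)).prod
    (bernoulliMeasure Γ τ)) with hP
  have hτj : τ.real {⟨j, hj⟩} = 1 / (N + 1) := by
    rw [measureReal_def, hτ, PMF.toMeasure_apply_singleton _ _ (measurableSet_singleton _)]
    simp [ENNReal.toReal_add]
  have hne : MeasurableSet {p | φ p ≠ φ' p} := (measurableSet_eq_fun hφ hφ').compl
  have hclose : ∀ i, P.real (resample i ⁻¹' {p | φ p ≠ φ' p}) < η / 3 := fun i => by
    rwa [measureReal_def,
      (measurePreserving_resample (τ := τ) i).measure_preimage hne.nullMeasurableSet]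
  have hclock : ∀ g, P.real {p | p.2 g = ⟨j, hj⟩} = 1 / (N + 1) := by
    intro g
    have h : MeasurePreserving (fun p : ((Y × (Γ → K)) × (Γ → K)) × (Γ → Fin (N + 1)) => p.2 g)
        P τ := (measurePreserving_eval_infinitePi (fun _ : Γ => τ) g).comp measurePreserving_snd
    rw [← hτj, measureReal_def, measureReal_def,
      ← h.measure_preimage (measurableSet_singleton _).nullMeasurableSet]
    rfl
  have hsub : {p | φ (resample j p) ≠ φ (resample (j + 1) p)} ⊆
      (resample j ⁻¹' {p | φ p ≠ φ' p} ∪ resample (j + 1) ⁻¹' {p | φ p ≠ φ' p}) ∪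
        ⋃ g ∈ W, {p | p.2 g = ⟨j, hj⟩} := by
    intro p hp
    by_contra hcon
    simp only [Set.mem_union, Set.mem_preimage, Set.mem_ofPred_eq, Set.mem_iUnion, not_or,
      not_not, not_exists] at hcon
    refine hp ?_
    rw [hcon.1.1, hcon.1.2]
    refine hdet _ _ (fun C _ => Iff.rfl) fun g hg D _ => ?_
    have hgj : ((p.2 g : Fin (N + 1)) : ℕ) ≠ j := fun h => hcon.2 g hg (Fin.ext h)
    simp only [resample, mixOn, Set.mem_ofPred_eq]
    split_ifs <;> first | rfl | omega
  have hWN : (W.card : ℝ) * (1 / (N + 1)) < η / 3 := by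
    rw [mul_one_div, div_lt_iff₀ (by positivity)]
    rw [div_lt_iff₀ (by positivity)] at hN
    nlinarith
  calc P.real {p | φ (resample j p) ≠ φ (resample (j + 1) p)}
      ≤ (P.real (resample j ⁻¹' {p | φ p ≠ φ' p}) +
          P.real (resample (j + 1) ⁻¹' {p | φ p ≠ φ' p})) +
          ∑ g ∈ W, P.real {p | p.2 g = ⟨j, hj⟩} := by
        refine (measureReal_mono hsub (measure_ne_top _ _)).trans
          ((measureReal_union_le _ _).trans ?_)
        exact add_le_add (measureReal_union_le _ _) (measureReal_biUnion_finset_le _ _)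
    _ < (η / 3 + η / 3) + η / 3 := by
        have := hclose j
        have := hclose (j + 1)
        simp only [hclock, Finset.sum_const, nsmul_eq_mul]
        linarith
    _ = η := by ring

end Mix

/-! ### Chains of microstates and total shattering -/

theorem normHamming_eq_freq {V A : Type*} [Fintype V] (x y : V → A) :
    normHamming x y = freq {v | x v ≠ y v} := rfl

theorem normHamming_triangle {V A : Type*} [Fintype V] (x y z : V → A) :
    normHamming x z ≤ normHamming x y + normHamming y z := by
  simp only [normHamming_eq_freq]
  refine (freq_mono fun v hv => ?_).trans (freq_union_le _ _)
  by_cases h : x v = y v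
  · exact Or.inr fun h' => hv (h.trans h')
  · exact Or.inl h

section Shattered

variable {Γ : Type*} [Group Γ] [Countable Γ] {V : ℕ → Type*} [∀ n, Fintype (V n)]
  [∀ n, Nonempty (V n)] {σ : ∀ n, Γ →* Equiv.Perm (V n)}
  {A : Type*} [Finite A] [TopologicalSpace A] [DiscreteTopology A] [MeasurableSpace A]
  [BorelSpace A] {μ : ProbabilityMeasure (Γ → A)}

/-- Totally shattered microstate spaces force near-factor maps from a product with a Bernoulli shift
to nearly ignore the Bernoulli coordinate. -/
theorem HasTotallyShatteredMicrostates.exists_nhds_forall_lt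
    (hshatt : HasTotallyShatteredMicrostates (fun n => ⇑(σ n)) μ)
    (hσ : IsSoficApproximation fun n => ⇑(σ n))
    (hcard : Tendsto (fun n => Fintype.card (V n)) atTop atTop) {ε : ℝ} (hε : 0 < ε) :
    ∃ O ∈ 𝓝 μ, ∀ (Y : Type uY) [MeasurableSpace Y] (θ : Measure Y) [IsProbabilityMeasure θ]
      (S : PMPAction Γ θ), AllModels σ S →
      ∀ (K : Type uK) [MeasurableSpace K] (κ : Measure K) [IsProbabilityMeasure κ]
        (φ : Y × (Γ → K) → A) (hφ : Measurable φ),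
        equivariantLaw (S.prod (bernoulliShift Γ κ)) hφ ∈ O →
        (θ.prod ((bernoulliMeasure Γ κ).prod (bernoulliMeasure Γ κ))).real
          {p | φ (p.1, p.2.1) ≠ φ (p.1, p.2.2)} < ε := by
  classical
  obtain ⟨-, δ, hδ, hdich⟩ := hshatt
  -- Closeness within `ε / 2` is needed for the conclusion, and within `δ / 2` for the chain to
  -- continue.
  obtain ⟨O, hO, n₀, hdich⟩ := hdich (min (ε / 2) (δ / 2)) (by positivity)
  refine ⟨interior O, interior_mem_nhds.2 hO, ?_⟩
  intro Y _ θ _ S hS K _ κ _ φ hφ hlaw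
  -- Because the law is an interior point of `O`, labellings that approximate this law, rather than
  -- `μ` itself, are still microstates in `O`.
  obtain ⟨W, η₁, hη₁, hloc⟩ := exists_local_nhds (mem_interior_iff_mem_nhds.1 hlaw)
  obtain ⟨N, τ, _, hstep⟩ := exists_resample_step_lt (θ := θ) (κ := κ) hφ
    (show 0 < δ / 4 by positivity)
  set P := (((θ.prod (bernoulliMeasure Γ κ)).prod (bernoulliMeasure Γ κ)).prod
    (bernoulliMeasure Γ τ)) with hP
  let R : PMPAction Γ P :=
    ((S.prod (bernoulliShift Γ κ)).prod (bernoulliShift Γ κ)).prod (bernoulliShift Γ τ)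
  -- All `N + 1` stages are modelled jointly, so that the model also records their mutual distances.
  let J : ((Y × (Γ → K)) × (Γ → K)) × (Γ → Fin N) → Fin (N + 1) → A :=
    fun p j => φ (resample j p)
  have hJ : Measurable J := measurable_pi_lambda _ fun j => hφ.comp (measurable_resample _)
  have hmodels : AllModels σ R := ((hS.prod_bernoulliShift hσ hcard κ).prod_bernoulliShift
    hσ hcard κ).prod_bernoulliShift hσ hcard τ
  have hη : 0 < min η₁ (min (δ / 4) (ε / 2)) := by positivity
  obtain ⟨n, ⟨x, hx⟩, hn⟩ := ((hmodels.hasModels hJ (insert 1 W) _ hη).and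
    (eventually_ge_atTop n₀)).exists
  have hη₁' := min_le_left η₁ (min (δ / 4) (ε / 2))
  have hηδ := (min_le_right η₁ (min (δ / 4) (ε / 2))).trans (min_le_left _ _)
  have hηε := (min_le_right η₁ (min (δ / 4) (ε / 2))).trans (min_le_right _ _)
  have hmicro : ∀ j : Fin (N + 1), (fun v => x v j) ∈ microstates (⇑(σ n)) O := by
    intro j
    refine hloc _ fun E hE => ?_
    have hEm := hE.measurableSet
    have hE' : IsLocal (insert 1 W) {b : Γ → Fin (N + 1) → A | (fun g => b g j) ∈ E} :=
      fun b c hbc hb => hE (fun g hg => congrFun (hbc g (Finset.mem_insert_of_mem hg)) j) hb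
    have h := (hx _ hE').trans_le hη₁'
    rw [empiricalMeasure_real _ _ hEm]
    -- The clock is part of the system and is shifted along with the samples, so `resample j` is
    -- equivariant and preserves the measure; every stage has the law of the original process.
    have hlawE : ((equivariantLaw (S.prod (bernoulliShift Γ κ)) hφ : ProbabilityMeasure (Γ → A)) :
        Measure (Γ → A)).real E =
        P.real {p | equivariantMap R J p ∈ {b : Γ → Fin (N + 1) → A | (fun g => b g j) ∈ E}} := by
      have hm := measurable_equivariantMap (S.prod (bernoulliShift Γ κ)) hφ
      change (Measure.map _ _).real E = _
      rw [map_measureReal_apply hm hEm, measureReal_def, measureReal_def,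
        ← (measurePreserving_resample (τ := τ) j).measure_preimage (hm hEm).nullMeasurableSet]
      rfl
    rw [hlawE]
    exact h
  have hdist : ∀ i j : Fin (N + 1), |normHamming (fun v => x v i) (fun v => x v j) -
      P.real {p | φ (resample i p) ≠ φ (resample j p)}| < min η₁ (min (δ / 4) (ε / 2)) := by
    intro i j
    have hE : IsLocal (insert 1 W) {b : Γ → Fin (N + 1) → A | b 1 i ≠ b 1 j} := by
      intro b c hbc hb
      have := hbc 1 (Finset.mem_insert_self _ _)
      simpa [← this] using hb
    have h := hx _ hE
    have h₁ : {v | pullbackName (⇑(σ n)) x v ∈ {b : Γ → Fin (N + 1) → A | b 1 i ≠ b 1 j}} =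
        {v | x v i ≠ x v j} := by
      ext v
      simp [pullbackName]
    have h₂ : P.real {p | equivariantMap R J p ∈ {b : Γ → Fin (N + 1) → A | b 1 i ≠ b 1 j}} =
        P.real {p | φ (resample i p) ≠ φ (resample j p)} := by
      refine measureReal_congr ?_
      filter_upwards [R.act_one] with p hp
      refine propext ?_
      change (J (R.act 1⁻¹ p) i ≠ J (R.act 1⁻¹ p) j) ↔ _
      rw [inv_one, hp]
      rfl
    rw [h₁, h₂] at h
    exact h
  have hchain : ∀ j : ℕ, ∀ hj : j < N + 1,
      normHamming (fun v => x v 0) (fun v => x v ⟨j, hj⟩) < min (ε / 2) (δ / 2) := by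
    intro j
    induction j with
    | zero =>
      intro hj
      have : (⟨0, hj⟩ : Fin (N + 1)) = 0 := rfl
      rw [this]
      simp only [normHamming, ne_eq, not_true_eq_false]
      simp [hε, hδ]
    | succ j ih =>
      intro hj
      have h₁ := ih (by omega)
      have h₂ := (abs_lt.1 (hdist ⟨j, by omega⟩ ⟨j + 1, hj⟩)).2
      have h₃ := hstep j (by omega)
      have h₄ := normHamming_triangle (fun v => x v 0) (fun v => x v ⟨j, by omega⟩)
        (fun v => x v ⟨j + 1, hj⟩)
      have h₅ := min_le_right (ε / 2) (δ / 2)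
      -- The far alternative fails: the distance is less than `δ / 2` so far, plus `δ / 4` for the
      -- step and `δ / 4` for the model error.
      refine (hdich n hn _ (hmicro 0) _ (hmicro ⟨j + 1, hj⟩)).resolve_left fun hge => ?_
      simp only at h₂
      linarith
  have hend := hchain N (Nat.lt_succ_self N)
  have h₁ := (abs_lt.1 (hdist 0 ⟨N, Nat.lt_succ_self N⟩)).1
  have h₂ := min_le_left (ε / 2) (δ / 2)
  have hset : P.real {p | φ (resample (0 : Fin (N + 1)) p) ≠
      φ (resample (⟨N, Nat.lt_succ_self N⟩ : Fin (N + 1)) p)} =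
      (θ.prod ((bernoulliMeasure Γ κ).prod (bernoulliMeasure Γ κ))).real
          {p | φ (p.1, p.2.1) ≠ φ (p.1, p.2.2)} := by
    have hm : MeasurableSet {p : Y × (Γ → K) × (Γ → K) | φ (p.1, p.2.1) ≠ φ (p.1, p.2.2)} :=
      (measurableSet_eq_fun (hφ.comp (by fun_prop)) (hφ.comp (by fun_prop))).compl
    have hmp := (measurePreserving_prodAssoc θ (bernoulliMeasure Γ κ) (bernoulliMeasure Γ κ)).comp
      (measurePreserving_fst (μ := (θ.prod (bernoulliMeasure Γ κ)).prod (bernoulliMeasure Γ κ))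
        (ν := bernoulliMeasure Γ τ))
    rw [measureReal_def, measureReal_def, ← hmp.measure_preimage hm.nullMeasurableSet]
    simp only [Fin.val_zero, resample_zero, resample_last]
    rfl
  rw [hset] at h₁
  linarith

end Shattered

/-! ### Factor maps and models -/

section Factor

set_option linter.unusedSectionVars false

variable {Γ : Type*} [Group Γ] [Countable Γ] {V : ℕ → Type*} [∀ n, Fintype (V n)]
  {σ : ∀ n, Γ →* Equiv.Perm (V n)}
  {X : Type*} [MeasurableSpace X] {μ : Measure X} [IsProbabilityMeasure μ] {T : PMPAction Γ μ}
  {Y : Type*} [MeasurableSpace Y] {θ : Measure Y} [IsProbabilityMeasure θ] {S : PMPAction Γ θ}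

/-- A map on the factor and its pullback along `ξ` have the same local statistics, so models of the
pullback serve. -/
theorem IsFactorMap.allModels {ξ : X → Y} (hξ : IsFactorMap T S ξ) (h : AllModels σ T) :
    AllModels σ S := by
  intro m φ hφ
  have hmod : HasModels σ T (φ ∘ ξ) := by
    refine (h m _ (hφ.comp hξ.aemeasurable.measurable_mk)).congr_ae ?_
    filter_upwards [hξ.aemeasurable.ae_eq_mk] with x hx
    simp [← hx]
  intro W η hη
  filter_upwards [hmod W η hη] with n hn
  obtain ⟨x, hx⟩ := hn
  refine ⟨x, fun E hE => ?_⟩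
  have hE' : MeasurableSet {y | equivariantMap S φ y ∈ E} :=
    measurable_equivariantMap S hφ hE.measurableSet
  have : θ.real {y | equivariantMap S φ y ∈ E} =
      μ.real {x | equivariantMap T (φ ∘ ξ) x ∈ E} := by
    have hpre : ∀ s, MeasurableSet s → θ.real s = μ.real (ξ ⁻¹' s) := fun s hs => by
      rw [← hξ.map_eq, measureReal_def, Measure.map_apply_of_aemeasurable hξ.aemeasurable hs]
      rfl
    rw [hpre _ hE']
    refine measureReal_congr ?_
    filter_upwards [ae_all_iff.2 fun g : Γ => hξ.equivariant g⁻¹] with x hx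
    refine propext ?_
    change _ ∈ E ↔ _ ∈ E
    rw [show equivariantMap S φ (ξ x) = equivariantMap T (φ ∘ ξ) x from
      funext fun g => congrArg φ (hx g).symm]
  rw [this]
  exact hx E hE

/-- A factor map onto a shift system is induced by a measurable map to the alphabet. -/
theorem IsFactorMap.exists_ae_eq_equivariantMap {A : Type*} [MeasurableSpace A]
    {ν : Measure (Γ → A)} {hν : IsShiftInvariant ν} {Φ : X → Γ → A}
    (hΦ : IsFactorMap T (shiftSystem hν) Φ) :
    ∃ φ : X → A, Measurable φ ∧ Φ =ᵐ[μ] equivariantMap T φ := by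
  refine ⟨fun x => hΦ.aemeasurable.mk Φ x 1,
    (measurable_pi_apply 1).comp hΦ.aemeasurable.measurable_mk, ?_⟩
  filter_upwards [ae_all_iff.2 fun g : Γ => hΦ.equivariant g⁻¹,
    ae_all_iff.2 fun g : Γ => (T.measurePreserving g⁻¹).quasiMeasurePreserving.ae
      hΦ.aemeasurable.ae_eq_mk] with x h₁ h₂
  funext g
  simp only [equivariantMap]
  rw [← h₂ g, h₁ g]
  simp [shiftSystem, shift]

variable [∀ n, Nonempty (V n)] {A : Type*} [Finite A] [TopologicalSpace A] [DiscreteTopology A]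
  [MeasurableSpace A] [BorelSpace A] {ρ : ProbabilityMeasure (Γ → A)}
  {hρ : IsShiftInvariant (ρ : Measure (Γ → A))}
  {K : Type*} [MeasurableSpace K] {κ : Measure K} [IsProbabilityMeasure κ]

/-- The law equals `ρ`, so the estimate holds for every `ε` and two Bernoulli samples almost surely
give the same value. Freezing one of them at a generic `z₀` exhibits `φ` as a function of `y`. -/
theorem HasTotallyShatteredMicrostates.exists_factorization
    (hshatt : HasTotallyShatteredMicrostates (fun n => ⇑(σ n)) ρ)
    (hσ : IsSoficApproximation fun n => ⇑(σ n))
    (hcard : Tendsto (fun n => Fintype.card (V n)) atTop atTop)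
    (hS : AllModels σ S) {Φ : Y × (Γ → K) → Γ → A}
    (hΦ : IsFactorMap (S.prod (bernoulliShift Γ κ)) (shiftSystem hρ) Φ) :
    ∃ Ψ : Y → Γ → A, Measurable Ψ ∧ IsFactorMap S (shiftSystem hρ) Ψ ∧
      ∀ᵐ p ∂(θ.prod (bernoulliMeasure Γ κ)), Φ p = Ψ p.1 := by
  obtain ⟨φ, hφ, hΦφ⟩ := hΦ.exists_ae_eq_equivariantMap
  have hlaw : equivariantLaw (S.prod (bernoulliShift Γ κ)) hφ = ρ :=
    Subtype.ext ((Measure.map_congr hΦφ).symm.trans hΦ.map_eq)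
  have hm : MeasurableSet {p : Y × (Γ → K) × (Γ → K) | φ (p.1, p.2.1) ≠ φ (p.1, p.2.2)} :=
    (measurableSet_eq_fun (hφ.comp (by fun_prop)) (hφ.comp (by fun_prop))).compl
  have hzero : (θ.prod ((bernoulliMeasure Γ κ).prod (bernoulliMeasure Γ κ))).real
      {p | φ (p.1, p.2.1) ≠ φ (p.1, p.2.2)} = 0 := by
    refine le_antisymm (le_of_forall_pos_lt_add fun ε hε => ?_) measureReal_nonneg
    obtain ⟨O, hO, h⟩ := hshatt.exists_nhds_forall_lt hσ hcard hε
    rw [zero_add]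
    exact h Y θ S hS K κ φ hφ (hlaw ▸ mem_of_mem_nhds hO)
  have hae : ∀ᵐ p ∂(θ.prod ((bernoulliMeasure Γ κ).prod (bernoulliMeasure Γ κ))),
      φ (p.1, p.2.1) = φ (p.1, p.2.2) := by
    rw [measureReal_eq_zero_iff] at hzero
    exact hzero
  -- The sample to be frozen is moved to the front for Fubini.
  have hae' : ∀ᵐ q ∂((bernoulliMeasure Γ κ).prod (θ.prod (bernoulliMeasure Γ κ))),
      φ q.2 = φ (q.2.1, q.1) :=
    ((measurePreserving_prodAssoc θ (bernoulliMeasure Γ κ) (bernoulliMeasure Γ κ)).comp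
      Measure.measurePreserving_swap).quasiMeasurePreserving.ae hae
  obtain ⟨z₀, hz₀⟩ := (Measure.ae_ae_of_ae_prod hae').exists
  have hψ : Measurable fun y => φ (y, z₀) := hφ.comp (by fun_prop)
  have hfst : ∀ᵐ p ∂(θ.prod (bernoulliMeasure Γ κ)),
      Φ p = equivariantMap S (fun y => φ (y, z₀)) p.1 := by
    filter_upwards [hΦφ, ae_all_iff.2 fun g : Γ =>
      ((S.prod (bernoulliShift Γ κ)).measurePreserving g⁻¹).quasiMeasurePreserving.ae hz₀]
      with p h₁ h₂
    rw [h₁]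
    exact funext h₂
  refine ⟨_, measurable_equivariantMap S hψ, isFactorMap_equivariantMap hψ hρ ?_, hfst⟩
  rw [← hΦ.map_eq, Measure.map_congr hfst]
  have hcomp : ∀ F : Y → Γ → A, Measurable F →
      θ.map F = (θ.prod (bernoulliMeasure Γ κ)).map fun p => F p.1 := fun F hF => by
    conv_lhs => rw [← (measurePreserving_fst (μ := θ) (ν := bernoulliMeasure Γ κ)).map_eq]
    rw [Measure.map_map hF measurable_fst]
    rfl
  exact hcomp _ (measurable_equivariantMap S hψ)

theorem IsFactorMap.comp_swap {ζ : Measure X} [IsProbabilityMeasure ζ] {R : PMPAction Γ ζ}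
    {Z : Type*} [MeasurableSpace Z] {ν : Measure Z} {Q : PMPAction Γ ν} {Φ : X × Y → Z}
    (h : IsFactorMap (R.prod S) Q Φ) : IsFactorMap (S.prod R) Q (Φ ∘ Prod.swap) := by
  have hswap : MeasurePreserving Prod.swap (θ.prod ζ) (ζ.prod θ) := Measure.measurePreserving_swap
  refine ⟨h.aemeasurable.comp_quasiMeasurePreserving hswap.quasiMeasurePreserving, ?_, fun g => ?_⟩
  · rw [← h.map_eq, ← AEMeasurable.map_map_of_aemeasurable (by rw [hswap.map_eq]; exact h.aemeasurable)
      hswap.measurable.aemeasurable, hswap.map_eq]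
  · exact hswap.quasiMeasurePreserving.ae (h.equivariant g)

/-- An event in the second coordinate is also an event in the first, hence independent of itself: `κ
D * κ D = κ D`. A zero-one measure on a standard Borel space is a point mass. `Measure.prod_prod`
holds for arbitrary sets, so `f` may be non-measurable. -/
theorem exists_eq_dirac_of_ae_prod_eq [StandardBorelSpace K] {f : Y → Γ → K}
    (h : ∀ᵐ p ∂(θ.prod (bernoulliMeasure Γ κ)), p.2 = f p.1) : ∃ k, κ = Measure.dirac k := by
  have hzo : IsZeroOneMeasure κ := by
    refine ⟨fun D hD => ?_⟩
    set C : Set (Γ → K) := {z | z 1 ∈ D} with hC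
    have hCm : MeasurableSet C := measurable_pi_apply 1 hD
    have hκ : bernoulliMeasure Γ κ C = κ D :=
      (measurePreserving_eval_infinitePi (fun _ : Γ => κ) 1).measure_preimage hD.nullMeasurableSet
    have h₁ : (θ.prod (bernoulliMeasure Γ κ)) ((f ⁻¹' C) ×ˢ C) =
        (θ.prod (bernoulliMeasure Γ κ)) (Set.univ ×ˢ C) := by
      refine measure_congr ?_
      filter_upwards [h] with p hp
      refine propext ?_
      change (f p.1 ∈ C ∧ p.2 ∈ C) ↔ (True ∧ p.2 ∈ C)
      rw [hp]
      simp
    have h₂ : (θ.prod (bernoulliMeasure Γ κ)) ((f ⁻¹' C) ×ˢ C) =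
        (θ.prod (bernoulliMeasure Γ κ)) ((f ⁻¹' C) ×ˢ Set.univ) := by
      refine measure_congr ?_
      filter_upwards [h] with p hp
      refine propext ?_
      change (f p.1 ∈ C ∧ p.2 ∈ C) ↔ (f p.1 ∈ C ∧ True)
      rw [hp]
      simp
    have h₃ := h₂.symm.trans h₁
    rw [Measure.prod_prod, Measure.prod_prod, measure_univ, measure_univ, mul_one, one_mul] at h₃
    rw [Measure.prod_prod, Measure.prod_prod, measure_univ, one_mul, h₃, hκ] at h₁
    by_cases h0 : κ D = 0
    · exact Or.inl h0
    · right
      have := congrArg (fun t => t / κ D) h₁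
      simpa [ENNReal.mul_div_cancel_right h0 (measure_ne_top κ D),
        ENNReal.div_self h0 (measure_ne_top κ D)] using this
  exact IsZeroOneMeasure.exists_eq_dirac

/-- The complement `Y` inherits models from `A^Γ`, so the inverse isomorphism `Λ` factors through
`Y`. Applying `π` to it returns the Bernoulli coordinate, now as a function of `y`. -/
theorem HasTotallyShatteredMicrostates.exists_eq_dirac_of_isDirectFactor
    [StandardBorelSpace K]
    (hshatt : HasTotallyShatteredMicrostates (fun n => ⇑(σ n)) ρ)
    (hσ : IsSoficApproximation fun n => ⇑(σ n))
    (hcard : Tendsto (fun n => Fintype.card (V n)) atTop atTop)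
    (h : IsDirectFactor.{uY} (bernoulliShift Γ κ) (shiftSystem hρ)) :
    ∃ k, κ = Measure.dirac k := by
  obtain ⟨Y, _, _, θ, _, S, π, ξ, hπ, hξ, -, Λ, hΛ, -, hright⟩ := h
  have hS : AllModels σ S := hξ.allModels (hshatt.1.allModels hρ)
  obtain ⟨Ψ, hΨm, hΨ, hΛΨ⟩ := hshatt.exists_factorization hσ hcard hS hΛ.comp_swap
  refine exists_eq_dirac_of_ae_prod_eq (θ := θ) (f := hπ.aemeasurable.mk π ∘ Ψ) ?_
  have hswap : MeasurePreserving Prod.swap (θ.prod (bernoulliMeasure Γ κ))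
    ((bernoulliMeasure Γ κ).prod θ) := Measure.measurePreserving_swap
  have hmk : ∀ᵐ y ∂θ, π (Ψ y) = hπ.aemeasurable.mk π (Ψ y) := by
    have := hπ.aemeasurable.ae_eq_mk
    exact ae_of_ae_map hΨm.aemeasurable (by rw [hΨ.map_eq]; exact this)
  filter_upwards [hΛΨ, hswap.quasiMeasurePreserving.ae hright,
    Measure.quasiMeasurePreserving_fst.ae hmk] with p h₁ h₂ h₃
  have h₄ : π (Λ p.swap) = p.2 := congrArg Prod.fst h₂
  rw [← h₄, Function.comp, ← h₃]
  exact congrArg π h₁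

end Factor

/-! ### Weak containment -/

section WeakContainment

set_option linter.unusedSectionVars false

variable {Γ : Type*} [Group Γ] [Countable Γ]
  {A : Type*} [Finite A] [TopologicalSpace A] [DiscreteTopology A]
  [MeasurableSpace A] [BorelSpace A] {μ : ProbabilityMeasure (Γ → A)}
  {hμ : IsShiftInvariant (μ : Measure (Γ → A))}
  {Y : Type*} [MeasurableSpace Y] {ν : Measure Y} [IsProbabilityMeasure ν] {S : PMPAction Γ ν}

/-- Weak containment of a shift system, in terms of the cylinder sets over a finite window. -/
theorem IsWeaklyContained.exists_patternSets (h : IsWeaklyContained (shiftSystem hμ) S)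
    (W : Finset Γ) {ε : ℝ} (hε : 0 < ε) :
    ∃ D : (W → A) → Set Y, (∀ p, MeasurableSet (D p)) ∧ ∀ g ∈ W, ∀ p q,
      |(μ : Measure (Γ → A)).real (shift g⁻¹ ⁻¹' (W.restrict ⁻¹' {p}) ∩ W.restrict ⁻¹' {q})
        - ν.real (S.act g⁻¹ ⁻¹' D p ∩ D q)| < ε := by
  obtain ⟨m, ⟨e⟩⟩ := Finite.exists_equiv_fin (W → A)
  obtain ⟨D, hD, hDε⟩ := h m (fun i => W.restrict ⁻¹' {e.symm i})
    (fun i => W.measurable_restrict (measurableSet_singleton _)) W ε hε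
  refine ⟨fun p => D (e p), fun p => hD _, fun g hg p q => ?_⟩
  simpa [shiftSystem] using hDε g hg (e p) (e q)

/-- The cylinders over `W` are copied to sets `D p`, which are almost disjoint and almost cover `Y`;
a point of `D p` is labelled by the value of `p` at `1`. Correlations under `g ∈ W` are copied too,
so points of `D p` and `D q` related by `g` with incompatible patterns are rare, and the labels seen
from most of `D p` spell out `p`. -/
theorem IsWeaklyContained.exists_equivariantLaw_mem (h : IsWeaklyContained (shiftSystem hμ) S)
    {O : Set (ProbabilityMeasure (Γ → A))} (hO : O ∈ 𝓝 μ) :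
    ∃ (φ : Y → A) (hφ : Measurable φ), equivariantLaw S hφ ∈ O := by
  classical
  obtain ⟨W₀, η, hη, hloc⟩ := exists_local_nhds hO
  set W := insert 1 W₀ with hW
  have h1W : (1 : Γ) ∈ W := Finset.mem_insert_self _ _
  cases nonempty_fintype (W → A)
  obtain ⟨m, hm⟩ : ∃ m : ℝ, m = ((Fintype.card (W → A) : ℕ) : ℝ) := ⟨_, rfl⟩
  have hm0 : 0 ≤ m := hm ▸ Nat.cast_nonneg _
  obtain ⟨w, hw⟩ : ∃ w : ℝ, w = (W.card : ℝ) := ⟨_, rfl⟩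
  have hw0 : 0 ≤ w := hw ▸ Nat.cast_nonneg _
  -- The total loss below is `m * (m + 1) * (2 * w + 1) * ε`; the extra `1` in the first factor
  -- keeps the denominator positive and the bound strict.
  obtain ⟨ε, hε⟩ : ∃ ε, ε = η / ((m * (m + 1) + 1) * (2 * w + 1)) := ⟨_, rfl⟩
  have hε0 : 0 < ε := by rw [hε]; positivity
  obtain ⟨D, hD, hDε⟩ := h.exists_patternSets W hε0
  set C : (W → A) → Set (Γ → A) := fun p => W.restrict ⁻¹' {p} with hC
  have hCm : ∀ p, MeasurableSet (C p) := fun p =>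
    W.measurable_restrict (measurableSet_singleton _)
  have hsum : ∀ s : Set (W → A), (μ : Measure (Γ → A)).real (W.restrict ⁻¹' s) =
      ∑ p ∈ s.toFinset, (μ : Measure (Γ → A)).real (C p) := fun s => by
    rw [sum_measureReal_preimage_singleton _ fun p _ => hCm p, Set.coe_toFinset]
  have hone : ∀ p q, ν.real (S.act 1⁻¹ ⁻¹' D p ∩ D q) = ν.real (D p ∩ D q) := fun p q => by
    refine measureReal_congr ?_
    filter_upwards [S.act_one] with y hy
    refine propext ?_
    change (S.act 1⁻¹ y ∈ D p ∧ y ∈ D q) ↔ (y ∈ D p ∧ y ∈ D q)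
    rw [inv_one, hy]
    rfl
  have hone' : ∀ p q, shift (1 : Γ)⁻¹ ⁻¹' C p ∩ C q = C p ∩ C q := fun p q => by
    have : (shift (1 : Γ)⁻¹ : (Γ → A) → Γ → A) = id := by
      funext a g
      simp [shift]
    rw [this]
    rfl
  -- Correlations at `g = 1` control overlaps and sizes, which is one reason for adding `1` to the
  -- window.
  have hinter : ∀ p q, p ≠ q → ν.real (D p ∩ D q) < ε := fun p q hpq => by
    have := hDε 1 h1W p q
    rw [hone, hone', show C p ∩ C q = ∅ from ?_] at this
    · rw [measureReal_empty, zero_sub, abs_neg] at this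
      exact (le_abs_self _).trans_lt this
    · refine Set.eq_empty_of_forall_notMem fun a ha => hpq ?_
      exact ha.1.symm.trans ha.2
  have hDC : ∀ p, (μ : Measure (Γ → A)).real (C p) - ε < ν.real (D p) := fun p => by
    have := hDε 1 h1W p p
    rw [hone, hone', Set.inter_self, Set.inter_self] at this
    linarith [(abs_lt.1 this).2]
  -- the parts of the sets `D p` outside all the others
  set D' : (W → A) → Set Y := fun p => D p \ ⋃ q ∈ Finset.univ.erase p, D q with hD'
  have hD'm : ∀ p, MeasurableSet (D' p) := fun p =>
    (hD p).diff (Finset.measurableSet_biUnion _ fun q _ => hD q)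
  have hD'disj : Pairwise fun p q => Disjoint (D' p) (D' q) := by
    intro p q hpq
    refine Set.disjoint_left.2 fun y hp hq => hp.2 ?_
    exact Set.mem_biUnion (Finset.mem_coe.2 (Finset.mem_erase.2 ⟨hpq.symm, Finset.mem_univ _⟩)) hq.1
  have hD'C : ∀ p, (μ : Measure (Γ → A)).real (C p) - (m + 1) * ε ≤ ν.real (D' p) := fun p => by
    have hsub : D p ⊆ D' p ∪ ⋃ q ∈ Finset.univ.erase p, D p ∩ D q := by
      intro y hy
      by_cases hy' : y ∈ ⋃ q ∈ Finset.univ.erase p, D q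
      · right
        simp only [Set.mem_iUnion] at hy' ⊢
        obtain ⟨q, hq, hyq⟩ := hy'
        exact ⟨q, hq, hy, hyq⟩
      · exact Or.inl ⟨hy, hy'⟩
    have h₁ : ν.real (⋃ q ∈ Finset.univ.erase p, D p ∩ D q) ≤ m * ε := by
      calc _ ≤ ∑ q ∈ Finset.univ.erase p, ν.real (D p ∩ D q) := measureReal_biUnion_finset_le _ _
        _ ≤ ∑ q ∈ Finset.univ.erase p, ε :=
            Finset.sum_le_sum fun q hq => (hinter p q (Finset.ne_of_mem_erase hq).symm).le
        _ ≤ ∑ _q : W → A, ε := Finset.sum_le_sum_of_subset_of_nonneg (Finset.subset_univ _)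
            fun _ _ _ => hε0.le
        _ = m * ε := by simp [hm]
    have h₂ := (measureReal_mono hsub (measure_ne_top ν _)).trans (measureReal_union_le _ _)
    linarith [hDC p]
  set U : Set Y := (⋃ p ∈ Finset.univ, D' p)ᶜ with hU
  have hUm : MeasurableSet U := (Finset.measurableSet_biUnion _ fun p _ => hD'm p).compl
  have hunion : ∀ s : Finset (W → A),
      ∑ p ∈ s, (μ : Measure (Γ → A)).real (C p) - m * ((m + 1) * ε) ≤
        ν.real (⋃ p ∈ s, D' p) := fun s => by
    rw [measureReal_biUnion_finset (fun p _ q _ hpq => hD'disj hpq) fun p _ => hD'm p]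
    have h₁ := Finset.sum_le_sum fun p (_ : p ∈ s) => hD'C p
    rw [Finset.sum_sub_distrib, Finset.sum_const, nsmul_eq_mul] at h₁
    have h₂ : (s.card : ℝ) * ((m + 1) * ε) ≤ m * ((m + 1) * ε) := by
      rw [hm]
      gcongr
      exact Finset.card_le_univ s
    linarith
  have hUle : ν.real U ≤ m * ((m + 1) * ε) := by
    have h₁ := hunion Finset.univ
    have h₂ : ∑ p, (μ : Measure (Γ → A)).real (C p) = 1 := by
      have := hsum Set.univ
      rw [Set.preimage_univ, probReal_univ] at this
      rw [this]
      exact Finset.sum_congr (by ext; simp) fun _ _ => rfl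
    rw [hU, probReal_compl_eq_one_sub (Finset.measurableSet_biUnion _ fun p _ => hD'm p)]
    linarith
  -- the label of a point
  have hlab : ∀ y, ∃ p : W → A, y ∉ U → y ∈ D' p := fun y => by
    by_cases hy : y ∈ U
    · obtain ⟨a⟩ : Nonempty (Γ → A) :=
        nonempty_of_isProbabilityMeasure (μ : Measure (Γ → A))
      exact ⟨W.restrict a, fun h => absurd hy h⟩
    · simp only [hU, Set.mem_compl_iff, not_not, Set.mem_iUnion] at hy
      obtain ⟨p, -, hp⟩ := hy
      exact ⟨p, fun _ => hp⟩
  obtain ⟨a₀⟩ : Nonempty (Γ → A) := nonempty_of_isProbabilityMeasure (μ : Measure (Γ → A))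
  -- At most one `p` qualifies, by disjointness; the default value is taken only on the small set
  -- `U`.
  let G : ((W → A) → Prop) → A := fun P => if h : ∃ p, P p then h.choose ⟨1, h1W⟩ else a₀ 1
  let φ : Y → A := fun y => G fun p => y ∈ D' p
  have hφ : Measurable φ := (measurable_of_finite G).comp
    (measurable_pi_lambda _ fun p => measurableSet_setOfPred.1 (hD'm p))
  have hφD' : ∀ p, ∀ y ∈ D' p, φ y = p ⟨1, h1W⟩ := by
    intro p y hy
    have hex : ∃ p, y ∈ D' p := ⟨p, hy⟩
    have : hex.choose = p := by
      by_contra hne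
      exact Set.disjoint_left.1 (hD'disj hne) hex.choose_spec hy
    simp only [φ, G, dif_pos hex, this]
  -- the points where the labels are inconsistent
  set B : Γ → Set Y := fun g =>
    (⋃ x ∈ (Finset.univ : Finset ((W → A) × (W → A))).filter
      (fun x => ¬ ∀ hg : g ∈ W, x.1 ⟨1, h1W⟩ = x.2 ⟨g, hg⟩), S.act g⁻¹ ⁻¹' D x.1 ∩ D x.2) ∪
      S.act g⁻¹ ⁻¹' U with hB
  have hBle : ∀ g ∈ W, ν.real (B g) ≤ 2 * (m * ((m + 1) * ε)) := by
    intro g hg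
    have h₁ : ν.real (S.act g⁻¹ ⁻¹' U) ≤ m * ((m + 1) * ε) := by
      rwa [measureReal_def, (S.measurePreserving g⁻¹).measure_preimage hUm.nullMeasurableSet]
    have h₂ : ν.real (⋃ x ∈ (Finset.univ : Finset ((W → A) × (W → A))).filter
        (fun x => ¬ ∀ hg : g ∈ W, x.1 ⟨1, h1W⟩ = x.2 ⟨g, hg⟩), S.act g⁻¹ ⁻¹' D x.1 ∩ D x.2) ≤
        m * ((m + 1) * ε) := by
      calc _ ≤ ∑ x ∈ (Finset.univ : Finset ((W → A) × (W → A))).filter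
            (fun x => ¬ ∀ hg : g ∈ W, x.1 ⟨1, h1W⟩ = x.2 ⟨g, hg⟩),
              ν.real (S.act g⁻¹ ⁻¹' D x.1 ∩ D x.2) := measureReal_biUnion_finset_le _ _
        _ ≤ ∑ x ∈ (Finset.univ : Finset ((W → A) × (W → A))).filter
            (fun x => ¬ ∀ hg : g ∈ W, x.1 ⟨1, h1W⟩ = x.2 ⟨g, hg⟩), ε := by
            refine Finset.sum_le_sum fun x hx => ?_
            have hx' := (Finset.mem_filter.1 hx).2
            have := hDε g hg x.1 x.2
            have hempty : shift g⁻¹ ⁻¹' (C x.1) ∩ C x.2 = ∅ := by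
              refine Set.eq_empty_of_forall_notMem fun a ha => hx' fun _ => ?_
              have e₁ : W.restrict (shift g⁻¹ a) = x.1 := ha.1
              have e₂ : W.restrict a = x.2 := ha.2
              rw [← e₁, ← e₂]
              simp [shift]
            rw [hempty, measureReal_empty, zero_sub, abs_neg] at this
            exact (le_abs_self _).trans this.le
        _ ≤ ∑ _x : (W → A) × (W → A), ε := Finset.sum_le_sum_of_subset_of_nonneg
            (Finset.subset_univ _) fun _ _ _ => hε0.le
        _ = m * (m * ε) := by
            rw [Finset.sum_const, Finset.card_univ, Fintype.card_prod, nsmul_eq_mul, hm]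
            push_cast
            ring
        _ ≤ m * ((m + 1) * ε) := by gcongr; linarith
    linarith [measureReal_union_le (μ := ν) (⋃ x ∈ (Finset.univ : Finset ((W → A) × (W → A))).filter
      (fun x => ¬ ∀ hg : g ∈ W, x.1 ⟨1, h1W⟩ = x.2 ⟨g, hg⟩), S.act g⁻¹ ⁻¹' D x.1 ∩ D x.2)
      (S.act g⁻¹ ⁻¹' U)]
  have hBall : ν.real (⋃ g ∈ W, B g) ≤ w * (2 * (m * ((m + 1) * ε))) := by
    calc _ ≤ ∑ g ∈ W, ν.real (B g) := measureReal_biUnion_finset_le _ _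
      _ ≤ ∑ g ∈ W, 2 * (m * ((m + 1) * ε)) := Finset.sum_le_sum hBle
      _ = _ := by rw [Finset.sum_const, nsmul_eq_mul, hw]
  have hagree : ∀ p, ∀ y ∈ D' p, y ∉ (⋃ g ∈ W, B g) → ∀ g : W, equivariantMap S φ y g = p g := by
    intro p y hy hyB g
    have hyg : y ∉ B g := fun h => hyB (Set.mem_biUnion g.2 h)
    obtain ⟨q, hq⟩ := hlab (S.act (g : Γ)⁻¹ y)
    have hq := hq fun h => hyg (Or.inr h)
    change φ (S.act (g : Γ)⁻¹ y) = p g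
    rw [hφD' q _ hq]
    by_contra hne
    refine hyg (Or.inl (Set.mem_biUnion (x := (q, p)) ?_ ⟨hq.1, hy.1⟩))
    simp only [Finset.coe_filter, Finset.mem_univ, true_and, Set.mem_ofPred_eq]
    exact fun h => hne (h g.2)
  have hsmall : m * ((m + 1) * ε) + w * (2 * (m * ((m + 1) * ε))) < η := by
    calc _ = (m * (m + 1)) * (2 * w + 1) * ε := by ring
      _ < ((m * (m + 1) + 1) * (2 * w + 1)) * ε := by gcongr; linarith
      _ = η := by rw [hε]; field_simp
  have hem := measurable_equivariantMap S hφ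
  have hlower : ∀ E, IsLocal W₀ E → (μ : Measure (Γ → A)).real E - η <
      ((equivariantLaw S hφ : ProbabilityMeasure (Γ → A)) : Measure (Γ → A)).real E := by
    intro E hE₀
    have hE : IsLocal W E := hE₀.mono (Finset.subset_insert _ _)
    have hlaw : ((equivariantLaw S hφ : ProbabilityMeasure (Γ → A)) : Measure (Γ → A)).real E =
        ν.real (equivariantMap S φ ⁻¹' E) := map_measureReal_apply hem hE.measurableSet
    have h₁ := hunion (W.restrict '' E).toFinset
    rw [← hsum, ← hE.eq_preimage] at h₁
    have hsub : (⋃ p ∈ (W.restrict '' E).toFinset, D' p) ⊆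
        equivariantMap S φ ⁻¹' E ∪ ⋃ g ∈ W, B g := by
      intro y hy
      by_cases hyB : y ∈ ⋃ g ∈ W, B g
      · exact Or.inr hyB
      · left
        simp only [Set.mem_iUnion, Set.mem_toFinset] at hy
        obtain ⟨p, ⟨a, ha, rfl⟩, hp⟩ := hy
        exact hE (fun g hg => (hagree _ y hp hyB ⟨g, hg⟩).symm) ha
    have h₂ := (measureReal_mono hsub (measure_ne_top ν _)).trans (measureReal_union_le _ _)
    rw [hlaw]
    linarith
  refine ⟨φ, hφ, hloc _ fun E hE => ?_⟩
  have h₁ := hlower E hE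
  -- The complement of a local event is local, so its lower bound is the missing upper bound.
  have h₂ := hlower Eᶜ fun a b hab ha hb => ha (hE (fun g hg => (hab g hg).symm) hb)
  rw [probReal_compl_eq_one_sub hE.measurableSet, probReal_compl_eq_one_sub hE.measurableSet] at h₂
  exact abs_lt.2 ⟨by linarith, by linarith⟩

end WeakContainment

/-! ### Triviality under weak containment in a Bernoulli shift -/

section Trivial

variable {Γ : Type*} [Group Γ] [Countable Γ] {V : ℕ → Type*} [∀ n, Fintype (V n)]
  [∀ n, Nonempty (V n)] {σ : ∀ n, Γ →* Equiv.Perm (V n)}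

/-- The one-point system. -/
def onePointSystem (Γ : Type*) [Group Γ] : PMPAction Γ (Measure.dirac ()) where
  act _ := id
  measurePreserving _ := MeasurePreserving.id _
  act_one := EventuallyEq.rfl
  act_mul _ _ := EventuallyEq.rfl

-- Constant labellings are exact models.
omit [Countable Γ] in
theorem allModels_onePointSystem : AllModels σ (onePointSystem Γ) := by
  intro m φ _ W η hη
  refine Eventually.of_forall fun n => ⟨fun _ => φ (), fun E _ => ?_⟩
  have h₁ : ∀ v, pullbackName (σ n) (fun _ => φ ()) v = fun _ => φ () := fun v => rfl
  have h₂ : ∀ y, equivariantMap (onePointSystem Γ) φ y = fun _ => φ () := fun y => rfl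
  simp only [h₁, h₂]
  by_cases hE : (fun _ => φ ()) ∈ E
  · have e₁ : {v : V n | (fun _ : Γ => φ ()) ∈ E} = Set.univ := Set.eq_univ_of_forall fun _ => hE
    have e₂ : {y : Unit | (fun _ : Γ => φ ()) ∈ E} = Set.univ := Set.eq_univ_of_forall fun _ => hE
    rw [e₁, e₂, freq_univ, probReal_univ, sub_self, abs_zero]
    exact hη
  · have e₁ : {v : V n | (fun _ : Γ => φ ()) ∈ E} = ∅ :=
      Set.eq_empty_of_forall_notMem fun _ => hE
    have e₂ : {y : Unit | (fun _ : Γ => φ ()) ∈ E} = ∅ :=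
      Set.eq_empty_of_forall_notMem fun _ => hE
    rw [e₁, e₂]
    simpa [freq] using hη

variable {A : Type*} [Finite A] [TopologicalSpace A] [DiscreteTopology A]
  [MeasurableSpace A] [BorelSpace A] {μ : ProbabilityMeasure (Γ → A)}
  {hμ : IsShiftInvariant (μ : Measure (Γ → A))}
  {K : Type*} [MeasurableSpace K] {κ : Measure K} [IsProbabilityMeasure κ]

/-- With the one-point system as first factor, the resampling estimate says that `φ` takes the same
value at two independent samples with high probability. Some sample `z` does at least as well as the
average, so `φ` is nearly constantly `φ z`; the neighbourhood for the window `{1}` transfers this to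
`μ`. -/
theorem HasTotallyShatteredMicrostates.exists_real_ne_lt
    (hshatt : HasTotallyShatteredMicrostates (fun n => ⇑(σ n)) μ)
    (hσ : IsSoficApproximation fun n => ⇑(σ n))
    (hcard : Tendsto (fun n => Fintype.card (V n)) atTop atTop)
    (h : IsWeaklyContained (shiftSystem hμ) (bernoulliShift Γ κ)) {ε : ℝ} (hε : 0 < ε) :
    ∃ a : A, (μ : Measure (Γ → A)).real {x | x 1 ≠ a} < ε := by
  obtain ⟨O, hO, hcore⟩ := hshatt.exists_nhds_forall_lt hσ hcard (half_pos hε)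
  obtain ⟨φ, hφ, hlaw⟩ := h.exists_equivariantLaw_mem
    (inter_mem hO (eventually_nhds_forall_isLocal μ {1} (half_pos hε)))
  have hφ' : Measurable fun p : Unit × (Γ → K) => φ p.2 := hφ.comp measurable_snd
  have hlaw' : equivariantLaw ((onePointSystem Γ).prod (bernoulliShift Γ κ)) hφ' =
      equivariantLaw (bernoulliShift Γ κ) hφ := by
    refine Subtype.ext ?_
    have hsnd := measurePreserving_snd (μ := Measure.dirac ()) (ν := bernoulliMeasure Γ κ)
    have hcomp : ∀ F : (Γ → K) → Γ → A, Measurable F → (bernoulliMeasure Γ κ).map F =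
        ((Measure.dirac ()).prod (bernoulliMeasure Γ κ)).map fun p => F p.2 := fun F hF => by
      conv_lhs => rw [← hsnd.map_eq]
      rw [Measure.map_map hF measurable_snd]
      rfl
    exact (hcomp _ (measurable_equivariantMap (bernoulliShift Γ κ) hφ)).symm
  have hdis := hcore Unit (Measure.dirac ()) (onePointSystem Γ) allModels_onePointSystem K κ _ hφ'
    (hlaw' ▸ hlaw.1)
  have hm : MeasurableSet {p : (Γ → K) × (Γ → K) | φ p.1 ≠ φ p.2} :=
    (measurableSet_eq_fun (hφ.comp measurable_fst) (hφ.comp measurable_snd)).compl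
  have hdis' : ((bernoulliMeasure Γ κ).prod (bernoulliMeasure Γ κ))
      {p | φ p.1 ≠ φ p.2} < ENNReal.ofReal (ε / 2) := by
    have hsnd := measurePreserving_snd (μ := Measure.dirac ())
      (ν := (bernoulliMeasure Γ κ).prod (bernoulliMeasure Γ κ))
    rw [← hsnd.measure_preimage hm.nullMeasurableSet, ← ofReal_measureReal (measure_ne_top _ _)]
    exact (ENNReal.ofReal_lt_ofReal_iff (half_pos hε)).2 hdis
  obtain ⟨z, hz⟩ : ∃ z, bernoulliMeasure Γ κ {z' | φ z ≠ φ z'} < ENNReal.ofReal (ε / 2) := by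
    by_contra! hcon
    refine hdis'.not_ge ?_
    rw [Measure.prod_apply hm]
    calc ENNReal.ofReal (ε / 2) = ∫⁻ _, ENNReal.ofReal (ε / 2) ∂(bernoulliMeasure Γ κ) := by simp
      _ ≤ _ := lintegral_mono hcon
  refine ⟨φ z, ?_⟩
  have hE : IsLocal {1} {x : Γ → A | x 1 ≠ φ z} := fun a b hab ha => by
    have := hab 1 (by simp)
    simpa [← this] using ha
  have h₁ := (abs_lt.1 (hlaw.2 _ hE)).1
  have h₂ : ((equivariantLaw (bernoulliShift Γ κ) hφ : ProbabilityMeasure (Γ → A)) :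
      Measure (Γ → A)).real {x | x 1 ≠ φ z} < ε / 2 := by
    have hlawE : ((equivariantLaw (bernoulliShift Γ κ) hφ : ProbabilityMeasure (Γ → A)) :
        Measure (Γ → A)).real {x | x 1 ≠ φ z} = (bernoulliMeasure Γ κ).real
          (equivariantMap (bernoulliShift Γ κ) φ ⁻¹' {x | x 1 ≠ φ z}) :=
      map_measureReal_apply (measurable_equivariantMap _ hφ) hE.measurableSet
    have hset : equivariantMap (bernoulliShift Γ κ) φ ⁻¹' {x | x 1 ≠ φ z} =
        {z' | φ z ≠ φ z'} := by
      ext z'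
      have : shift (1 : Γ)⁻¹ z' = z' := by
        funext g
        simp [shift]
      simp only [Set.mem_preimage, Set.mem_ofPred_eq, equivariantMap, bernoulliShift, shiftSystem,
        this]
      exact ne_comm
    rw [hlawE, hset, measureReal_def]
    exact ENNReal.toReal_lt_of_lt_ofReal hz
  linarith

theorem HasTotallyShatteredMicrostates.eq_dirac_of_isWeaklyContained
    (hshatt : HasTotallyShatteredMicrostates (fun n => ⇑(σ n)) μ)
    (hσ : IsSoficApproximation fun n => ⇑(σ n))
    (hcard : Tendsto (fun n => Fintype.card (V n)) atTop atTop)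
    (h : IsWeaklyContained (shiftSystem hμ) (bernoulliShift Γ κ)) :
    ∃ a : A, (μ : Measure (Γ → A)) = Measure.dirac fun _ => a := by
  obtain ⟨a, ha⟩ : ∃ a : A, (μ : Measure (Γ → A)).real {x | x 1 ≠ a} = 0 := by
    obtain ⟨x⟩ : Nonempty (Γ → A) := nonempty_of_isProbabilityMeasure (μ : Measure (Γ → A))
    have : Nonempty A := ⟨x 1⟩
    -- The letter from `exists_real_ne_lt` may depend on `ε`; a minimizer over the finite alphabet
    -- serves all `ε` at once.
    obtain ⟨a₀, ha₀⟩ := Finite.exists_min fun a : A =>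
      (μ : Measure (Γ → A)).real {x | x 1 ≠ a}
    refine ⟨a₀, le_antisymm (not_lt.1 fun hpos => ?_) measureReal_nonneg⟩
    obtain ⟨a, ha⟩ := hshatt.exists_real_ne_lt hσ hcard h hpos
    exact (ha₀ a).not_gt ha
  have hae : ∀ᵐ x ∂(μ : Measure (Γ → A)), x 1 = a := by
    rw [measureReal_eq_zero_iff] at ha
    exact ha
  -- Shift invariance carries the value at coordinate `1` to all of the countably many coordinates.
  have hconst : ∀ᵐ x ∂(μ : Measure (Γ → A)), x = fun _ => a := by
    have : ∀ᵐ x ∂(μ : Measure (Γ → A)), ∀ g, shift g⁻¹ x 1 = a := ae_all_iff.2 fun g =>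
      ((shiftSystem hμ).measurePreserving g⁻¹).quasiMeasurePreserving.ae hae
    filter_upwards [this] with x hx
    funext g
    simpa [shift] using hx g
  refine ⟨a, ?_⟩
  calc (μ : Measure (Γ → A)) = (μ : Measure (Γ → A)).map id := Measure.map_id.symm
    _ = (μ : Measure (Γ → A)).map (fun _ _ => a) := Measure.map_congr hconst
    _ = Measure.dirac fun _ => a := by simp [Measure.map_const]

end Trivial

end SoficShift

theorem mainTheorem8
    {Γ : Type uΓ} [Group Γ] [Countable Γ]
    {V : ℕ → Type uV} [∀ n, Fintype (V n)] [∀ n, Nonempty (V n)]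
    (σ : ∀ n, Γ →* Equiv.Perm (V n))
    (hσ : IsSoficApproximation (fun n => ⇑(σ n)))
    (hV : Finite Γ → Tendsto (fun n => Fintype.card (V n)) atTop atTop)
    {A : Type uA} [Finite A] [TopologicalSpace A] [DiscreteTopology A] [MeasurableSpace A]
    [BorelSpace A]
    (μ : ProbabilityMeasure (Γ → A)) (hμ : IsShiftInvariant (μ : Measure (Γ → A)))
    (hshatt : HasTotallyShatteredMicrostates (fun n => ⇑(σ n)) μ) :
    -- near-factor maps from a product with a Bernoulli shift nearly ignore the Bernoulli coordinate
    (∀ ε : ℝ, 0 < ε → ∃ O ∈ 𝓝 μ,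
      ∀ (B : Type uB) [Finite B] [TopologicalSpace B] [DiscreteTopology B] [MeasurableSpace B]
        [BorelSpace B] (ν : ProbabilityMeasure (Γ → B))
        (hν : IsShiftInvariant (ν : Measure (Γ → B))),
        HasMicrostates (fun n => ⇑(σ n)) ν →
      ∀ (K : Type uK) [MeasurableSpace K] [StandardBorelSpace K]
        (κ : Measure K) [IsProbabilityMeasure κ]
        (φ : (Γ → B) × (Γ → K) → A) (hφ : Measurable φ),
        equivariantLaw ((shiftSystem hν).prod (bernoulliShift Γ κ)) hφ ∈ O →
        ((ν : Measure (Γ → B)).prod ((bernoulliMeasure Γ κ).prod (bernoulliMeasure Γ κ))).real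
          {p | φ (p.1, p.2.1) ≠ φ (p.1, p.2.2)} < ε) ∧
    -- factor maps from a product with a Bernoulli shift factorize through the other coordinate
    (∀ (Y : Type uY) [MeasurableSpace Y] [StandardBorelSpace Y]
        (θ : Measure Y) [IsProbabilityMeasure θ] (S : PMPAction Γ θ),
        SystemHasMicrostates (fun n => ⇑(σ n)) S →
      ∀ (K : Type uK) [MeasurableSpace K] [StandardBorelSpace K]
        (κ : Measure K) [IsProbabilityMeasure κ]
        (Φ : Y × (Γ → K) → Γ → A),
        IsFactorMap (S.prod (bernoulliShift Γ κ)) (shiftSystem hμ) Φ →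
        ∃ Ψ : Y → Γ → A, IsFactorMap S (shiftSystem hμ) Ψ ∧
          ∀ᵐ p ∂(θ.prod (bernoulliMeasure Γ κ)), Φ p = Ψ p.1) ∧
    -- every direct Bernoulli factor is trivial
    (∀ (K : Type uK) [MeasurableSpace K] [StandardBorelSpace K]
        (κ : Measure K) [IsProbabilityMeasure κ],
        IsDirectFactor.{uY} (bernoulliShift Γ κ) (shiftSystem hμ) →
        ∃ k : K, κ = Measure.dirac k) ∧
    -- the system is not weakly contained in a Bernoulli shift unless it is trivial
    (∀ (K : Type uK) [MeasurableSpace K] [StandardBorelSpace K]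
        (κ : Measure K) [IsProbabilityMeasure κ],
        IsWeaklyContained (shiftSystem hμ) (bernoulliShift Γ κ) →
        ∃ a : A, (μ : Measure (Γ → A)) = Measure.dirac (fun _ => a)) := by
  have hcard := tendsto_card_atTop hσ hV
  refine ⟨fun ε hε => ?_, ?_, ?_, ?_⟩
  · obtain ⟨O, hO, h⟩ := hshatt.exists_nhds_forall_lt hσ hcard hε
    exact ⟨O, hO, fun B _ _ _ _ _ ν hν hmicro K _ _ κ _ φ hφ hlaw =>
      h (Γ → B) ν (shiftSystem hν) (hmicro.allModels hν) K κ φ hφ hlaw⟩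
  · intro Y _ _ θ _ S hS K _ _ κ _ Φ hΦ
    obtain ⟨Ψ, -, hΨ⟩ := hshatt.exists_factorization hσ hcard hS.allModels hΦ
    exact ⟨Ψ, hΨ⟩
  · intro K _ _ κ _ h
    exact hshatt.exists_eq_dirac_of_isDirectFactor hσ hcard h
  · intro K _ _ κ _ h
    exact hshatt.eq_dirac_of_isWeaklyContained hσ hcard h
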